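/- Let $M$ be a smooth manifold, let $\mathcal A\to M$ be a Lie algebroid (a smooth vector bundle with an $\mathbb R$-Lie bracket $[\cdot,\cdot]_{\mathcal A}$ on $\Gamma(\mathcal A)$ and a bundle map $a_{\mathcal A}\colon\mathcal A\to TM$ with $[x,fy]_{\mathcal A}=f[x,y]_{\mathcal A}+a_{\mathcal A}(x)(f)y$), and let $\rho$ be a representation of $\mathcal A$ on a smooth vector bundle $E\to M$, that is, $\rho\colon\Gamma(\mathcal A)\times\Gamma(E)\to\Gamma(E)$ is $\mathbb R$-bilinear with $\rho(fx)u=f\rho(x)u$, $\rho(x)(fu)=f\rho(x)u+a_{\mathcal A}(x)(f)u$ and $\rho([x,y]_{\mathcal A})=\rho(x)\rho(y)-\rho(y)\rho(x)$. Let $T\colon E\to\mathcal A$ be a relative Rota–Baxter operator: a bundle map over $\mathrm{id}_M$ with $[Tu,Tv]_{\mathcal A}=T(\rho(Tu)v-\rho(Tv)u)$ for all $u,v\in\Gamma(E)$. Then $(E,\ast_T,a_{\mathcal A}\circ T)$, $u\ast_T v=\rho(Tu)v$, is a left-symmetric algebroid. For $k\ge0$ let $\mathcal C^k(E,\mathcal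 A)=\Gamma(\mathrm{Hom}(\wedge^kE,\mathcal A))$. For $P\in\mathcal C^n(E,\mathcal A)$ and $Q\in\mathcal C^m(E,\mathcal A)$ put $$\begin{aligned}{}[\![P,Q]\!](u_1,\dots,u_{m+n})={}&\sum_{\sigma\in\mathbb S_{(m,1,n-1)}}(-1)^\sigma P(\rho(Q(u_{\sigma(1)},\dots,u_{\sigma(m)}))u_{\sigma(m+1)},u_{\sigma(m+2)},\dots,u_{\sigma(m+n)})\\&-(-1)^{mn}\sum_{\sigma\in\mathbb S_{(n,1,m-1)}}(-1)^\sigma Q(\rho(P(u_{\sigma(1)},\dots,u_{\sigma(n)}))u_{\sigma(n+1)},u_{\sigma(n+2)},\dots,u_{\sigma(m+n)})\\&+(-1)^{mn}\sum_{\sigma\in\mathbb S_{(n,m)}}(-1)^\sigma[P(u_{\sigma(1)},\dots,u_{\sigma(n)}),Q(u_{\sigma(n+1)},\dots,u_{\sigma(n+m)})]_{\mathcal A},\end{aligned}$$ where the sums run over unshuffles (permutations increasing on each of the indicated consecutive blocks of positions; a sum with a block of length $-1$ is zero), and let $\mathrm d_TP=(-1)^k[\![T,P]\!]$ for $P\in\mathcal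 C^k(E,\mathcal A)$. For $n\ge0$ let $\mathrm{Der}^n(E)$ be the space of multiderivations of degree $n$: $\mathbb R$-multilinear maps $D\colon\wedge^n\Gamma(E)\otimes\Gamma(E)\to\Gamma(E)$ that are $C^\infty(M)$-linear in the first $n$ arguments and satisfy $D(u_1,\dots,u_n,fu_{n+1})=fD(u_1,\dots,u_{n+1})+\sigma_D(u_1,\dots,u_n)(f)u_{n+1}$ for some symbol $\sigma_D\in\Gamma(\mathrm{Hom}(\wedge^nE,TM))$. For $D_1\in\mathrm{Der}^n(E)$ and $D_2\in\mathrm{Der}^m(E)$ put $[D_1,D_2]_{\mathrm{MN}}=D_1\circ D_2-(-1)^{mn}D_2\circ D_1$, where $$\begin{aligned}(D_1\circ D_2)(u_1,\dots,u_{m+n+1})={}&\sum_{\sigma\in\mathbb S_{(m,1,n-1)}}(-1)^\sigma D_1(D_2(u_{\sigma(1)},\dots,u_{\sigma(m+1)}),u_{\sigma(m+2)},\dots,u_{\sigma(m+n)},u_{m+n+1})\\&+(-1)^{mn}\sum_{\sigma\in\mathbb S_{(n,m)}}(-1)^\sigma D_1(u_{\sigma(1)},\dots,u_{\sigma(n)},D_2(u_{\sigma(n+1)},\dots,u_{\sigma(m+n)},u_{m+n+1})).\end{aligned}$$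 For the left-symmetric algebroid $(E,\ast_T,a_{\mathcal A}\circ T)$ with $\pi(u,v)=u\ast_Tv$ let $\mathrm d_{\mathrm{def}}D=(-1)^n[\pi,D]_{\mathrm{MN}}$ for $D\in\mathrm{Der}^n(E)$. Finally let $\Phi(P)(u_1,\dots,u_k,u_{k+1})=\rho(P(u_1,\dots,u_k))u_{k+1}$ for $P\in\mathcal C^k(E,\mathcal A)$. Then $(\mathcal C^*(E,\mathcal A),\mathrm d_T)$ and $(\mathrm{Der}^*(E),\mathrm d_{\mathrm{def}})$ are cochain complexes, $\Phi$ maps $\mathcal C^k(E,\mathcal A)$ into $\mathrm{Der}^k(E)$ for every $k\ge 0$, and $\Phi$ is a cochain map: $\mathrm d_{\mathrm{def}}\circ\Phi=\Phi\circ\mathrm d_T$. Consequently, for every $k\ge0$, $[P]\mapsto[\Phi(P)]$ is a well-defined homomorphism $\Phi_*\colon\mathcal H^k_T(E,\mathcal A)\to\mathrm H^k_{\mathrm{def}}(E)$ from the cohomology groups of $T$ to the deformation cohomology groups of the induced left-symmetric algebroid. -/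

import Mathlib

open Bundle Set Function
open scoped Manifold ContDiff Bundle

noncomputable section

namespace LieAlgd

section Sections

variable {B : Type*} [NormedAddCommGroup B] [NormedSpace ℝ B] {H : Type*} [TopologicalSpace H]
  (I : ModelWithCorners ℝ B H) {M : Type*} [TopologicalSpace M] [ChartedSpace H M]
  (F : Type*) [NormedAddCommGroup F] [NormedSpace ℝ F]
  (V : M → Type*) [TopologicalSpace (TotalSpace F V)] [∀ x, AddCommGroup (V x)]
  [∀ x, Module ℝ (V x)] [∀ x, TopologicalSpace (V x)] [FiberBundle F V] [VectorBundle ℝ F V]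
  (F' : Type*) [NormedAddCommGroup F'] [NormedSpace ℝ F']
  (W : M → Type*) [TopologicalSpace (TotalSpace F' W)] [∀ x, AddCommGroup (W x)]
  [∀ x, Module ℝ (W x)] [∀ x, TopologicalSpace (W x)] [FiberBundle F' W] [VectorBundle ℝ F' W]
  [∀ x, IsTopologicalAddGroup (W x)] [∀ x, ContinuousSMul ℝ (W x)]

/-- The space `Γ(V)` of smooth sections of a vector bundle `V` with model fibre `F`. -/
abbrev Sec : Type _ := ContMDiffSection I F ∞ V

/-- Smooth vector bundle maps `V → W` over the identity of `M`, that is, smooth sections of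
`Hom(V, W)`. -/
abbrev BundleMap : Type _ :=
  ContMDiffSection I (F →L[ℝ] F') ∞ (fun x => V x →L[ℝ] W x)

variable {I F V F' W}

/-- The product `f s` of a smooth function and a smooth section. -/
def fsmul (f : C^∞⟮I, M; ℝ⟯) (s : Sec I F V) : Sec I F V :=
  ⟨fun x => f x • s x, f.contMDiff.smul_section s.contMDiff⟩

/-- The derivative `X(f)` of a function along a tangent vector field. -/
def dirDeriv (X : ∀ x : M, TangentSpace I x) (f : C^∞⟮I, M; ℝ⟯) (x : M) : ℝ :=
  mvfderiv I (f : M → ℝ) x (X x)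

/-- The map `Γ(V) → Γ(W)` induced by a bundle map `V → W`. -/
def BundleMap.onSec (T : BundleMap I F V F' W) : Sec I F V →ₗ[ℝ] Sec I F' W where
  toFun s := ⟨fun x => T x (s x), T.contMDiff.clm_bundle_apply s.contMDiff⟩
  map_add' s t := by ext x; exact map_add (T x) (s x) (t x)
  map_smul' c s := by ext x; exact map_smul (T x) c (s x)

@[simp] theorem BundleMap.onSec_apply (T : BundleMap I F V F' W) (s : Sec I F V) (x : M) :
    T.onSec s x = T x (s x) := rfl

/-- The composite of two smooth bundle maps. -/
def BundleMap.comp {F'' : Type*} [NormedAddCommGroup F''] [NormedSpace ℝ F'']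
    {Z : M → Type*} [TopologicalSpace (TotalSpace F'' Z)] [∀ x, AddCommGroup (Z x)]
    [∀ x, Module ℝ (Z x)] [∀ x, TopologicalSpace (Z x)] [FiberBundle F'' Z]
    [VectorBundle ℝ F'' Z] [∀ x, IsTopologicalAddGroup (Z x)] [∀ x, ContinuousSMul ℝ (Z x)]
    (S : BundleMap I F' W F'' Z) (T : BundleMap I F V F' W) : BundleMap I F V F'' Z :=
  ⟨fun x => (S x).comp (T x), by
    intro x₀
    have hS := (contMDiffAt_hom_bundle _).1 (S.contMDiff x₀)
    have hT := (contMDiffAt_hom_bundle _).1 (T.contMDiff x₀)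
    refine (contMDiffAt_hom_bundle _).2 ⟨contMDiffAt_id, ?_⟩
    refine (hS.2.clm_comp hT.2).congr_of_eventuallyEq ?_
    have hW := (trivializationAt F' W x₀).open_baseSet.mem_nhds
      (FiberBundle.mem_baseSet_trivializationAt' x₀)
    filter_upwards [hW] with x hx
    ext v
    simp [ContinuousLinearMap.inCoordinates, hx]⟩

@[simp] theorem BundleMap.comp_apply {F'' : Type*} [NormedAddCommGroup F''] [NormedSpace ℝ F'']
    {Z : M → Type*} [TopologicalSpace (TotalSpace F'' Z)] [∀ x, AddCommGroup (Z x)]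
    [∀ x, Module ℝ (Z x)] [∀ x, TopologicalSpace (Z x)] [FiberBundle F'' Z]
    [VectorBundle ℝ F'' Z] [∀ x, IsTopologicalAddGroup (Z x)] [∀ x, ContinuousSMul ℝ (Z x)]
    (S : BundleMap I F' W F'' Z) (T : BundleMap I F V F' W) (x : M) :
    S.comp T x = (S x).comp (T x) := rfl

end Sections

/-! ### Unshuffles -/

/-- `(p;q)`-unshuffles: permutations of `p + q` letters that increase on the first `p` letters and
on the last `q` letters. -/
def unshuffles (p q : ℕ) : Set (Equiv.Perm (Fin (p + q))) :=
  {σ | StrictMono (fun i : Fin p => σ (Fin.castAdd q i)) ∧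
    StrictMono (fun j : Fin q => σ (Fin.natAdd p j))}

/-- `(m,1,n-1)`-unshuffles: permutations of `m + n` letters that increase on the first `m` letters
and on the last `n - 1` letters (the letter in position `m` being free). There are none for
`n = 0`. -/
def unshuffles₁ (m n : ℕ) : Set (Equiv.Perm (Fin (m + n))) :=
  {σ | 0 < n ∧ StrictMono (fun i : Fin m => σ (Fin.castAdd n i)) ∧
    StrictMonoOn (fun j : Fin n => σ (Fin.natAdd m j)) {j | 0 < j.val}}

section Brackets

variable {U X Y : Type*} [AddCommGroup X] [AddCommGroup Y] [Module ℝ X] [Module ℝ Y]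

open Classical in
/-- `∑_{σ ∈ S_(m,1,n-1)} (-1)^σ P(Q(u_σ(1), …, u_σ(m); u_σ(m+1)), u_σ(m+2), …, u_σ(m+n))`. -/
def insertSum {n m : ℕ} (P : (Fin n → U) → X) (Q : (Fin m → U) → U → U)
    (u : Fin (m + n) → U) : X :=
  ∑ σ : Equiv.Perm (Fin (m + n)) with σ ∈ unshuffles₁ m n,
    (Equiv.Perm.sign σ : ℤ) • P (fun j =>
      if j.val = 0 then
        Q (fun i => u (σ (Fin.castAdd n i))) (u (σ (Fin.natAdd m j)))
      else u (σ (Fin.natAdd m j)))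

open Classical in
/-- `∑_{σ ∈ S_(n,m)} (-1)^σ β(P(u_σ(1), …, u_σ(n)), Q(u_σ(n+1), …, u_σ(n+m)))`. -/
def shuffleSum {Z : Type*} {n m : ℕ} (β : Z → Y → X) (P : (Fin n → U) → Z)
    (Q : (Fin m → U) → Y) (u : Fin (n + m) → U) : X :=
  ∑ σ : Equiv.Perm (Fin (n + m)) with σ ∈ unshuffles n m,
    (Equiv.Perm.sign σ : ℤ) •
      β (P (fun i => u (σ (Fin.castAdd m i)))) (Q (fun j => u (σ (Fin.natAdd n j))))

/-- Relabelling of `n + m` arguments as `m + n` arguments, in the same order. -/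
def recast {n m : ℕ} (u : Fin (m + n) → U) : Fin (n + m) → U :=
  fun i => u (Fin.cast (Nat.add_comm n m) i)

end Brackets

section Structures

variable {B : Type*} [NormedAddCommGroup B] [NormedSpace ℝ B] {H : Type*} [TopologicalSpace H]
  (I : ModelWithCorners ℝ B H) {M : Type*} [TopologicalSpace M] [ChartedSpace H M]
  [IsManifold I ∞ M]
  (FA : Type*) [NormedAddCommGroup FA] [NormedSpace ℝ FA]
  (A : M → Type*) [TopologicalSpace (TotalSpace FA A)] [∀ x, AddCommGroup (A x)]
  [∀ x, Module ℝ (A x)] [∀ x, TopologicalSpace (A x)] [FiberBundle FA A] [VectorBundle ℝ FA A]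
  [∀ x, IsTopologicalAddGroup (A x)] [∀ x, ContinuousSMul ℝ (A x)]
  (FE : Type*) [NormedAddCommGroup FE] [NormedSpace ℝ FE]
  (E : M → Type*) [TopologicalSpace (TotalSpace FE E)] [∀ x, AddCommGroup (E x)]
  [∀ x, Module ℝ (E x)] [∀ x, TopologicalSpace (E x)] [FiberBundle FE E] [VectorBundle ℝ FE E]

/-- A Lie algebroid structure on the vector bundle `A → M`: a Lie bracket on `Γ(A)` and an anchor
`A → TM` satisfying the Leibniz rule. -/
structure LieAlgebroid where
  bracket : Sec I FA A →ₗ[ℝ] Sec I FA A →ₗ[ℝ] Sec I FA A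
  bracket_self : ∀ x, bracket x x = 0
  jacobi : ∀ x y z,
    bracket x (bracket y z) + bracket y (bracket z x) + bracket z (bracket x y) = 0
  anchor : BundleMap I FA A B (TangentSpace I : M → Type _)
  leibniz : ∀ (x y : Sec I FA A) (f : C^∞⟮I, M; ℝ⟯) (p : M),
    bracket x (fsmul f y) p
      = f p • bracket x y p + dirDeriv (anchor.onSec x) f p • y p

variable {I FA A}

/-- A representation of a Lie algebroid `A` on a vector bundle `E`: a base-preserving morphism from
`A` to the Lie algebroid of covariant differential operators of `E`, written on sections. -/
structure Representation (𝒜 : LieAlgebroid I FA A) where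
  act : Sec I FA A →ₗ[ℝ] Sec I FE E →ₗ[ℝ] Sec I FE E
  act_fsmul : ∀ (f : C^∞⟮I, M; ℝ⟯) x u, act (fsmul f x) u = fsmul f (act x u)
  act_leibniz : ∀ (x : Sec I FA A) (u : Sec I FE E) (f : C^∞⟮I, M; ℝ⟯) (p : M),
    act x (fsmul f u) p = f p • act x u p + dirDeriv (𝒜.anchor.onSec x) f p • u p
  act_bracket : ∀ x y u, act (𝒜.bracket x y) u = act x (act y u) - act y (act x u)

variable (I FA A)

/-- A left-symmetric algebroid structure on the vector bundle `A → M`. -/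
structure LeftSymmetricAlgebroid where
  mul : Sec I FA A →ₗ[ℝ] Sec I FA A →ₗ[ℝ] Sec I FA A
  left_symm : ∀ x y z,
    mul x (mul y z) - mul (mul x y) z = mul y (mul x z) - mul (mul y x) z
  anchor : BundleMap I FA A B (TangentSpace I : M → Type _)
  mul_leibniz : ∀ (x y : Sec I FA A) (f : C^∞⟮I, M; ℝ⟯) (p : M),
    mul x (fsmul f y) p = f p • mul x y p + dirDeriv (anchor.onSec x) f p • y p
  fsmul_mul : ∀ (f : C^∞⟮I, M; ℝ⟯) x y, mul (fsmul f x) y = fsmul f (mul x y)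

variable {I FA A FE E}

/-- `T : E → A` is a relative Rota–Baxter operator for the Lie algebroid `A` and its
representation `ρ` on `E`. -/
def IsRelRotaBaxter {𝒜 : LieAlgebroid I FA A} (ρ : Representation FE E 𝒜)
    (T : BundleMap I FE E FA A) : Prop :=
  ∀ u v : Sec I FE E, 𝒜.bracket (T.onSec u) (T.onSec v)
    = T.onSec (ρ.act (T.onSec u) v - ρ.act (T.onSec v) u)

/-- The left-symmetric algebroid `(E, ∗_T, a_A ∘ T)`, `u ∗_T v = ρ(T u) v`, induced by a relative
Rota–Baxter operator `T`. -/
def inducedLSA {𝒜 : LieAlgebroid I FA A} (ρ : Representation FE E 𝒜)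
    (T : BundleMap I FE E FA A) (hT : IsRelRotaBaxter ρ T) : LeftSymmetricAlgebroid I FE E where
  mul := ρ.act ∘ₗ T.onSec
  left_symm u v w := by
    have h := ρ.act_bracket (T.onSec u) (T.onSec v) w
    rw [hT u v, map_sub, map_sub, LinearMap.sub_apply] at h
    simp only [LinearMap.comp_apply]
    rw [sub_eq_sub_iff_add_eq_add] at h ⊢
    rw [add_comm, ← sub_eq_zero]
    rw [← sub_eq_zero] at h
    rw [← neg_eq_zero, ← h]
    abel
  anchor := 𝒜.anchor.comp T
  mul_leibniz u v f p := ρ.act_leibniz (T.onSec u) v f p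
  fsmul_mul f u v := by
    have h : T.onSec (fsmul f u) = fsmul f (T.onSec u) := by
      ext p; exact map_smul (T p) (f p) (u p)
    simp only [LinearMap.comp_apply, h]
    exact ρ.act_fsmul f _ v

/-! ### Cochains, multiderivations and their brackets

Cochains and multiderivations are realised inside the spaces of all operators of the given number
of sections, on which the brackets are defined by their formulas. -/

variable (I FE E FA A)

/-- All operators `Γ(E)^k → Γ(A)`. -/
abbrev Op (k : ℕ) : Type _ := (Fin k → Sec I FE E) → Sec I FA A

/-- All operators `Γ(E)^n × Γ(E) → Γ(E)`. -/
abbrev Op₁ (n : ℕ) : Type _ := (Fin n → Sec I FE E) → Sec I FE E → Sec I FE E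

/-- The space `C^k(E, A) = Γ(Hom(∧^k E, A))`: operators given pointwise by alternating
`k`-linear maps `E_p × ⋯ × E_p → A_p`. The smoothness of this field of alternating maps in `p` is
the fact that it takes smooth sections to smooth sections. -/
def cochains (k : ℕ) : Submodule ℝ (Op I FA A FE E k) where
  carrier := {P | ∃ φ : ∀ p : M, E p [⋀^Fin k]→ₗ[ℝ] A p,
    ∀ (u : Fin k → Sec I FE E) (p : M), P u p = φ p (fun i => u i p)}
  zero_mem' := ⟨fun _ => 0, fun _ _ => rfl⟩
  add_mem' := by
    rintro P Q ⟨φ, hφ⟩ ⟨ψ, hψ⟩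
    refine ⟨fun p => φ p + ψ p, fun u p => ?_⟩
    simp [hφ, hψ]
  smul_mem' := by
    rintro c P ⟨φ, hφ⟩
    refine ⟨fun p => c • φ p, fun u p => ?_⟩
    simp [hφ]

/-- `D` is a multiderivation of degree `n` with symbol `σ`: it is multilinear over `ℝ`, alternating
and function-linear in the first `n` arguments, and satisfies the Leibniz rule in the last
argument, where `σ` is a smooth section of `Hom(∧^n E, TM)`. -/
structure IsMultiderivation (n : ℕ) (D : Op₁ I FE E n)
    (σ : Op I B (TangentSpace I : M → Type _) FE E n) : Prop where
  symbol_mem : σ ∈ cochains I B (TangentSpace I : M → Type _) FE E n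
  multilinear : ∃ L : Sec I FE E [⋀^Fin n]→ₗ[ℝ] (Sec I FE E →ₗ[ℝ] Sec I FE E),
    ∀ u v, D u v = L u v
  fsmul_left : ∀ (f : C^∞⟮I, M; ℝ⟯) (u : Fin n → Sec I FE E) (i : Fin n) (v : Sec I FE E),
    D (Function.update u i (fsmul f (u i))) v = fsmul f (D u v)
  leibniz : ∀ (f : C^∞⟮I, M; ℝ⟯) (u : Fin n → Sec I FE E) (v : Sec I FE E) (p : M),
    D u (fsmul f v) p = f p • D u v p + dirDeriv (σ u) f p • v p

/-- The space `Der^n(E)` of multiderivations of degree `n`. -/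
def Der (n : ℕ) : Submodule ℝ (Op₁ I FE E n) where
  carrier := {D | ∃ σ, IsMultiderivation I FE E n D σ}
  zero_mem' := by
    refine ⟨0, Submodule.zero_mem _, ⟨0, fun _ _ => rfl⟩, ?_, ?_⟩
    · intro f u i v; ext p; simp [fsmul]
    · intro f u v p; simp [dirDeriv]
  add_mem' := by
    rintro D D' ⟨σ, h⟩ ⟨σ', h'⟩
    obtain ⟨L, hL⟩ := h.multilinear
    obtain ⟨L', hL'⟩ := h'.multilinear
    refine ⟨σ + σ', Submodule.add_mem _ h.symbol_mem h'.symbol_mem,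
      ⟨L + L', fun u v => by simp [hL, hL']⟩, ?_, ?_⟩
    · intro f u i v
      simp only [Pi.add_apply, h.fsmul_left, h'.fsmul_left]
      ext p; simp [fsmul]
    · intro f u v p
      simp only [Pi.add_apply, ContMDiffSection.coe_add, h.leibniz, h'.leibniz, dirDeriv,
        map_add, add_smul, smul_add]
      abel
  smul_mem' := by
    rintro c D ⟨σ, h⟩
    obtain ⟨L, hL⟩ := h.multilinear
    refine ⟨c • σ, Submodule.smul_mem _ c h.symbol_mem,
      ⟨c • L, fun u v => by simp [hL]⟩, ?_, ?_⟩
    · intro f u i v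
      simp only [Pi.smul_apply, h.fsmul_left]
      ext p; simp [fsmul, smul_comm c]
    · intro f u v p
      simp only [Pi.smul_apply, ContMDiffSection.coe_smul, h.leibniz, dirDeriv,
        map_smul, smul_add, smul_assoc, smul_comm c]

variable {I FE E FA A}

/-- The map `Φ(P)(u_1, …, u_k, u_{k+1}) = ρ(P(u_1, …, u_k)) u_{k+1}`. -/
def Phi {𝒜 : LieAlgebroid I FA A} (ρ : Representation FE E 𝒜) (k : ℕ) :
    Op I FA A FE E k →ₗ[ℝ] Op₁ I FE E k where
  toFun P := fun u v => ρ.act (P u) v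
  map_add' P Q := by ext u v; simp
  map_smul' c P := by ext u v; simp

/-- The graded Lie bracket `[[P, Q]]` of a cochain `P` of degree `n` and a cochain `Q` of
degree `m`. -/
def cochainBracket {𝒜 : LieAlgebroid I FA A} (ρ : Representation FE E 𝒜) {n m : ℕ}
    (P : Op I FA A FE E n) (Q : Op I FA A FE E m) : Op I FA A FE E (m + n) :=
  fun u => insertSum P (Phi ρ m Q) u
    - (-1 : ℝ) ^ (m * n) • insertSum Q (Phi ρ n P) (recast u)
    + (-1 : ℝ) ^ (m * n) • shuffleSum (fun x y => 𝒜.bracket x y) P Q (recast u)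

/-- The product `D₁ ∘ D₂` of operators of degrees `n` and `m` underlying the
Matsushima–Nijenhuis bracket. -/
def circ {n m : ℕ} (D₁ : Op₁ I FE E n) (D₂ : Op₁ I FE E m) : Op₁ I FE E (m + n) :=
  fun u v => insertSum (fun w => D₁ w v) D₂ u
    + (-1 : ℝ) ^ (m * n) • shuffleSum (fun (d : Sec I FE E → Sec I FE E) w => d w)
        D₁ (fun w => D₂ w v) (recast u)

/-- The Matsushima–Nijenhuis bracket `[D₁, D₂] = D₁ ∘ D₂ - (-1)^{mn} D₂ ∘ D₁` of operators of
degrees `n` and `m`. -/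
def mnBracket {n m : ℕ} (D₁ : Op₁ I FE E n) (D₂ : Op₁ I FE E m) : Op₁ I FE E (m + n) :=
  fun u v => circ D₁ D₂ u v - (-1 : ℝ) ^ (m * n) • circ D₂ D₁ (recast u) v

/-- A bundle map `T : E → A` as a cochain of degree one. -/
def asCochain (T : BundleMap I FE E FA A) : Op I FA A FE E 1 := fun u => T.onSec (u 0)

/-- The multiplication of a left-symmetric algebroid as a multiderivation of degree one. -/
def LeftSymmetricAlgebroid.asDer (L : LeftSymmetricAlgebroid I FE E) : Op₁ I FE E 1 :=
  fun u v => L.mul (u 0) v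

/-- The differential `d_T P = (-1)^k [[T, P]]` on cochains of degree `k`. -/
def dT {𝒜 : LieAlgebroid I FA A} (ρ : Representation FE E 𝒜) (T : BundleMap I FE E FA A)
    (k : ℕ) : Op I FA A FE E k →ₗ[ℝ] Op I FA A FE E (k + 1) where
  toFun P := (-1 : ℝ) ^ k • cochainBracket ρ (asCochain T) P
  map_add' P Q := by
    rw [← smul_add]
    congr 1
    ext1 u
    simp only [cochainBracket, insertSum, shuffleSum, asCochain, Phi, Pi.add_apply,
      LinearMap.coe_mk, AddHom.coe_mk, map_add, smul_add,
      Finset.sum_add_distrib, if_true, Fin.val_zero]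
    abel
  map_smul' c P := by
    rw [RingHom.id_apply, smul_comm c]
    congr 1
    ext1 u
    simp only [cochainBracket, insertSum, shuffleSum, asCochain, Phi, Pi.smul_apply,
      LinearMap.coe_mk, AddHom.coe_mk, map_smul, smul_add, smul_sub,
      Finset.smul_sum, if_true, Fin.val_zero, smul_comm c]

/-- The differential `d_def D = (-1)^n [π, D]` on multiderivations of degree `n`, where `π` is the
multiplication of the left-symmetric algebroid. -/
def dDef (L : LeftSymmetricAlgebroid I FE E) (n : ℕ) :
    Op₁ I FE E n →ₗ[ℝ] Op₁ I FE E (n + 1) where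
  toFun D := (-1 : ℝ) ^ n • mnBracket L.asDer D
  map_add' D D' := by
    rw [← smul_add]
    congr 1
    ext1 u
    ext1 v
    simp only [mnBracket, circ, insertSum, shuffleSum, LeftSymmetricAlgebroid.asDer,
      Pi.add_apply, map_add, LinearMap.add_apply, smul_add,
      Finset.sum_add_distrib, if_true, Fin.val_zero]
    abel
  map_smul' c D := by
    rw [RingHom.id_apply, smul_comm c]
    congr 1
    ext1 u
    ext1 v
    simp only [mnBracket, circ, insertSum, shuffleSum, LeftSymmetricAlgebroid.asDer,
      Pi.smul_apply, map_smul, LinearMap.smul_apply, smul_add, smul_sub,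
      Finset.smul_sum, if_true, Fin.val_zero, smul_comm c]

/-! ### Cohomology -/

/-- Cocycles of degree `k` of a relative Rota–Baxter operator. -/
def cocyclesT {𝒜 : LieAlgebroid I FA A} (ρ : Representation FE E 𝒜)
    (T : BundleMap I FE E FA A) (k : ℕ) : Submodule ℝ (Op I FA A FE E k) :=
  cochains I FA A FE E k ⊓ LinearMap.ker (dT ρ T k)

/-- Coboundaries of degree `k` of a relative Rota–Baxter operator. -/
def coboundariesT {𝒜 : LieAlgebroid I FA A} (ρ : Representation FE E 𝒜)
    (T : BundleMap I FE E FA A) : (k : ℕ) → Submodule ℝ (Op I FA A FE E k)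
  | 0 => ⊥
  | k + 1 => (cochains I FA A FE E k).map (dT ρ T k)

/-- The cohomology group `H^k_T(E, A)`. -/
abbrev HT {𝒜 : LieAlgebroid I FA A} (ρ : Representation FE E 𝒜)
    (T : BundleMap I FE E FA A) (k : ℕ) : Type _ :=
  cocyclesT ρ T k ⧸ (coboundariesT ρ T k).submoduleOf (cocyclesT ρ T k)

/-- Cocycles of degree `k` of the deformation complex. -/
def cocyclesDef (L : LeftSymmetricAlgebroid I FE E) (k : ℕ) : Submodule ℝ (Op₁ I FE E k) :=
  Der I FE E k ⊓ LinearMap.ker (dDef L k)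

/-- Coboundaries of degree `k` of the deformation complex. -/
def coboundariesDef (L : LeftSymmetricAlgebroid I FE E) :
    (k : ℕ) → Submodule ℝ (Op₁ I FE E k)
  | 0 => ⊥
  | k + 1 => (Der I FE E k).map (dDef L k)

/-- The deformation cohomology group `H^k_def`. -/
abbrev HDef (L : LeftSymmetricAlgebroid I FE E) (k : ℕ) : Type _ :=
  cocyclesDef L k ⧸ (coboundariesDef L k).submoduleOf (cocyclesDef L k)

end Structures

end LieAlgd

end

/-! Both complexes are Chevalley–Eilenberg complexes of one Lie algebra: `Γ(E)` with the commutator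
of the pre-Lie product `u ∗ v = ρ(Tu)v`. Writing the unshuffle sums out gives `d_T` as the
differential with coefficients in `Γ(A)`, where `θ(u)x = [Tu, x] + T(ρ(x)u)`, and `d_def` as the one
with coefficients in `End Γ(E)`, where `Θ(u)φ = [L_u, φ] + L_{φ(u)}` (`dT_alternatingMap`,
`dDef_alternatingMap`). Since `ρ(θ(u)x) = Θ(u)ρ(x)`, composition with `ρ`, which is `Φ`, commutes
with the differentials.

For a pre-Lie algebra the differential is the alternation of `∇_u P = θ(u) ∘ P - L_u · P`. Left
symmetry makes `∇` flat, and the bracket is the commutator of the product, so `∇` is also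
torsion-free. Hence `∇_u ∇_v P - ∇_{uv} P` is symmetric in `u, v` and its alternation, the square of
the differential, vanishes (`ceDiff_ceDiff`).

What remains is geometric: the differentials must preserve function-linearity and the existence of
symbols. The derivatives of `f` coming from the product and from the action cancel
(`ceDiff_update`), and function-linear operators on sections are pointwise
(`mem_cochains_of_update_fsmul`). For multiderivations the same argument is run on pairs `(D, σ_D)`,
with `Θ` extended to pairs. Carrying the symbol as data produces the symbol of `d_def D`; when `E`
has rank zero, `D` alone does not determine one. -/

noncomputable section

namespace LieAlgd

/-! ### Chevalley–Eilenberg differential of a pre-Lie algebra. -/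

section PreLie

variable {R V N : Type*} [CommRing R] [AddCommGroup V] [Module R V] [AddCommGroup N] [Module R N]

/-- The action of an endomorphism `A` of `V` as a derivation on alternating maps on `V`. -/
def derivAlt {k : ℕ} (A : Module.End R V) (P : V [⋀^Fin k]→ₗ[R] N) : V [⋀^Fin k]→ₗ[R] N where
  toMultilinearMap := ∑ j : Fin k, P.toMultilinearMap.compLinearMap
    (fun i => Function.update (fun _ => LinearMap.id) j A i)
  map_eq_zero_of_eq' := by
    intro w i j hw hij
    have key : ∀ l, (P.toMultilinearMap.compLinearMap
        (fun i => Function.update (fun _ => LinearMap.id) l A i)) w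
        = P (Function.update w l (A (w l))) := by
      intro l
      rw [MultilinearMap.compLinearMap_apply]
      refine congrArg P (funext fun m => ?_)
      by_cases h : m = l
      · subst h; simp
      · simp [h]
    simp only [MultilinearMap.toFun_eq_coe, sum_apply, key]
    -- If `w i = w j`, the terms with `A` in slot `i` and in slot `j` differ by a transposition and
    -- cancel; every other term still has two equal arguments.
    rw [← Finset.add_sum_erase _ _ (Finset.mem_univ i),
      ← Finset.add_sum_erase _ _ (Finset.mem_erase.2 ⟨hij.symm, Finset.mem_univ j⟩),
      Finset.sum_eq_zero, add_zero]
    · have h : Function.update w i (A (w i)) = Function.update w j (A (w j)) ∘ Equiv.swap i j := by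
        ext m
        rcases eq_or_ne m i with rfl | hi
        · simp [hw]
        · rcases eq_or_ne m j with rfl | hj
          · simp [hi, hij, hw]
          · simp [hi, hj, Equiv.swap_apply_of_ne_of_ne]
      rw [h, P.map_swap _ hij, neg_add_cancel]
    · intro l hl
      simp only [Finset.mem_erase] at hl
      exact P.map_eq_zero_of_eq _ (by simp [hl.1.symm, hl.2.1.symm, hw]) hij

theorem derivAlt_apply {k : ℕ} (A : Module.End R V) (P : V [⋀^Fin k]→ₗ[R] N) (w : Fin k → V) :
    derivAlt A P w = ∑ j, P (Function.update w j (A (w j))) := by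
  change (∑ j : Fin k, P.toMultilinearMap.compLinearMap
    (fun i => Function.update (fun _ => LinearMap.id) j A i)) w = _
  rw [sum_apply]
  refine Finset.sum_congr rfl fun l _ => ?_
  rw [MultilinearMap.compLinearMap_apply]
  refine congrArg P (funext fun m => ?_)
  by_cases h : m = l
  · subst h; simp
  · simp [h]

/-- Terms with `A` and `B` in different slots are symmetric in the two operators and cancel. Where
both hit one slot they compose in reverse order, because precomposition is contravariant. -/
theorem derivAlt_derivAlt_sub {k : ℕ} (A B : Module.End R V) (P : V [⋀^Fin k]→ₗ[R] N) :
    derivAlt A (derivAlt B P) - derivAlt B (derivAlt A P) = derivAlt (B * A - A * B) P := by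
  have expand : ∀ (A B : Module.End R V) (w : Fin k → V), derivAlt A (derivAlt B P) w
      = ∑ j, (P (Function.update w j (B (A (w j)))) + ∑ i ∈ Finset.univ.erase j,
        P (Function.update (Function.update w j (A (w j))) i (B (w i)))) := by
    intro A B w
    rw [derivAlt_apply]
    refine Finset.sum_congr rfl fun j _ => ?_
    rw [derivAlt_apply, ← Finset.add_sum_erase _ _ (Finset.mem_univ j)]
    congr 1
    · simp
    · refine Finset.sum_congr rfl fun i hi => ?_
      rw [Function.update_of_ne (Finset.mem_erase.1 hi).1]
  ext w
  rw [AlternatingMap.sub_apply, expand, expand, derivAlt_apply, Finset.sum_add_distrib,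
    Finset.sum_add_distrib]
  have hsymm : ∑ j, ∑ i ∈ Finset.univ.erase j,
        P (Function.update (Function.update w j (A (w j))) i (B (w i)))
      = ∑ j, ∑ i ∈ Finset.univ.erase j,
        P (Function.update (Function.update w j (B (w j))) i (A (w i))) := by
    rw [Finset.sum_comm' (t' := Finset.univ) (s' := fun i => Finset.univ.erase i)]
    · refine Finset.sum_congr rfl fun i _ => Finset.sum_congr rfl fun j hj => ?_
      rw [Function.update_comm (Finset.mem_erase.1 hj).1.symm]
    · intro i j; simp [eq_comm]
  rw [hsymm, add_sub_add_right_eq_sub, ← Finset.sum_sub_distrib]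
  refine Finset.sum_congr rfl fun j _ => ?_
  simp [AlternatingMap.map_update_sub]

variable (mul : V →ₗ[R] Module.End R V) (θ : V →ₗ[R] Module.End R N)

/-- The covariant derivative `∇_u P = θ(u) ∘ P - L_u · P` of alternating maps on `V` with values in
`N`, where `L_u` is the left multiplication by `u`. -/
def covDeriv (k : ℕ) :
    V →ₗ[R] (V [⋀^Fin k]→ₗ[R] N) →ₗ[R] (V [⋀^Fin k]→ₗ[R] N) :=
  LinearMap.mk₂ R (fun u P => (θ u).compAlternatingMap P - derivAlt (mul u) P)
    (by
      intro u v P; ext w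
      simp [derivAlt_apply, AlternatingMap.map_update_add, Finset.sum_add_distrib]; abel)
    (by
      intro c u P; ext w
      simp [derivAlt_apply, AlternatingMap.map_update_smul, Finset.smul_sum, smul_sub])
    (by
      intro u P Q; ext w
      simp [derivAlt_apply, Finset.sum_add_distrib]; abel)
    (by
      intro c u P; ext w
      simp [derivAlt_apply, Finset.smul_sum, smul_sub])

theorem covDeriv_eq {k : ℕ} (u : V) (P : V [⋀^Fin k]→ₗ[R] N) :
    covDeriv mul θ k u P = (θ u).compAlternatingMap P - derivAlt (mul u) P := rfl

theorem covDeriv_apply {k : ℕ} (u : V) (P : V [⋀^Fin k]→ₗ[R] N) (w : Fin k → V) :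
    covDeriv mul θ k u P w
      = θ u (P w) - ∑ j, P (Function.update w j (mul u (w j))) := by
  simp [covDeriv_eq, derivAlt_apply]

/-- The Chevalley–Eilenberg differential of the commutator bracket of `mul`, as the alternation of
the covariant derivative. -/
def ceDiff (k : ℕ) (P : V [⋀^Fin k]→ₗ[R] N) : V [⋀^Fin (k + 1)]→ₗ[R] N :=
  AlternatingMap.alternatizeUncurryFin ((covDeriv mul θ k).flip P)

theorem ceDiff_apply {k : ℕ} (P : V [⋀^Fin k]→ₗ[R] N) (u : Fin (k + 1) → V) :
    ceDiff mul θ k P u = ∑ i : Fin (k + 1), (-1) ^ (i : ℕ) •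
      (θ (u i) (P (i.removeNth u))
        - ∑ j, P (Function.update (i.removeNth u) j (mul (u i) (i.removeNth u j)))) := by
  rw [ceDiff, AlternatingMap.alternatizeUncurryFin_apply]
  refine Finset.sum_congr rfl fun i _ => ?_
  rw [LinearMap.flip_apply, covDeriv_apply]

/-- Alternation is natural, so `∇_u` may be taken inside it. The slot fed to `η` contributes `-η ∘
L_u`, the other slots and the values contribute `∇_u ∘ η`. -/
theorem covDeriv_alternatizeUncurryFin {k : ℕ} (u : V) (η : V →ₗ[R] V [⋀^Fin k]→ₗ[R] N) :
    covDeriv mul θ (k + 1) u (AlternatingMap.alternatizeUncurryFin η)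
      = AlternatingMap.alternatizeUncurryFin (covDeriv mul θ k u ∘ₗ η - η ∘ₗ mul u) := by
  ext w
  simp only [covDeriv_apply, AlternatingMap.alternatizeUncurryFin_apply, map_sum]
  rw [Finset.sum_comm, ← Finset.sum_sub_distrib]
  refine Finset.sum_congr rfl fun i _ => ?_
  rw [Fin.sum_univ_succAbove _ i]
  simp only [LinearMap.sub_apply, LinearMap.comp_apply, AlternatingMap.sub_apply, covDeriv_apply,
    Function.update_self, Fin.removeNth_update, Fin.removeNth_update_succAbove]
  have h : ∀ j, Function.update w (i.succAbove j) (mul u (w (i.succAbove j))) i = w i :=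
    fun j => Function.update_of_ne (Fin.ne_succAbove i j) _ _
  simp only [h, Fin.removeNth_apply, map_zsmul, smul_sub, Finset.smul_sum]
  abel

variable {mul θ}

/-- Flatness of `∇`: left symmetry says that `L` represents the commutator bracket, `θ` does so by
hypothesis, and the actions on arguments and on values commute. -/
theorem covDeriv_covDeriv_sub {k : ℕ}
    (hmul : ∀ u v w, mul u (mul v w) - mul (mul u v) w = mul v (mul u w) - mul (mul v u) w)
    (hθ : ∀ u v n, θ (mul u v - mul v u) n = θ u (θ v n) - θ v (θ u n))
    (u v : V) (P : V [⋀^Fin k]→ₗ[R] N) :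
    covDeriv mul θ k u (covDeriv mul θ k v P) - covDeriv mul θ k v (covDeriv mul θ k u P)
      = covDeriv mul θ k (mul u v - mul v u) P := by
  have hm : mul (mul u v - mul v u) = mul u * mul v - mul v * mul u := by
    ext w
    have := hmul u v w
    rw [sub_eq_sub_iff_add_eq_add] at this
    simp only [map_sub, LinearMap.sub_apply, Module.End.mul_apply]
    rw [sub_eq_sub_iff_add_eq_add, this, add_comm]
  have hd := derivAlt_derivAlt_sub (mul v) (mul u) P
  rw [← hm] at hd
  ext w
  rw [covDeriv_eq _ _ (_ - _), ← hd]
  have h := hθ u v (P w)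
  simp only [map_sub, LinearMap.sub_apply] at h
  simp only [covDeriv_eq, AlternatingMap.sub_apply, LinearMap.compAlternatingMap_apply, map_sub,
    LinearMap.sub_apply, h]
  simp only [derivAlt_apply, LinearMap.compAlternatingMap_apply, map_sum]
  abel

theorem ceDiff_ceDiff {k : ℕ}
    (hmul : ∀ u v w, mul u (mul v w) - mul (mul u v) w = mul v (mul u w) - mul (mul v u) w)
    (hθ : ∀ u v n, θ (mul u v - mul v u) n = θ u (θ v n) - θ v (θ u n))
    (P : V [⋀^Fin k]→ₗ[R] N) : ceDiff mul θ (k + 1) (ceDiff mul θ k P) = 0 := by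
  -- The second covariant derivative of `P`; its symmetry is flatness together with vanishing
  -- torsion.
  let f : V →ₗ[R] V →ₗ[R] V [⋀^Fin k]→ₗ[R] N :=
    LinearMap.mk₂ R (fun u v => covDeriv mul θ k u (covDeriv mul θ k v P)
      - covDeriv mul θ k (mul u v) P)
      (by intros; simp only [map_add, LinearMap.add_apply]; abel)
      (by intros; simp only [map_smul, LinearMap.smul_apply, smul_sub])
      (by intros; simp only [map_add, LinearMap.add_apply]; abel)
      (by intros; simp only [map_smul, LinearMap.smul_apply, smul_sub])
  have hf : ∀ u v, f u v = f v u := by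
    intro u v
    have := covDeriv_covDeriv_sub hmul hθ u v P
    simp only [map_sub, LinearMap.sub_apply] at this
    simp only [f, LinearMap.mk₂_apply]
    rw [sub_eq_sub_iff_add_eq_add] at this ⊢
    rw [this, add_comm]
  rw [← AlternatingMap.alternatizeUncurryFin_alternatizeUncurryFinLM_comp_of_symmetric hf,
    ceDiff]
  congr 1
  ext1 u
  rw [LinearMap.flip_apply, ceDiff, covDeriv_alternatizeUncurryFin]
  rfl

end PreLie

/-! ### Unshuffle sums in which one of the operators has degree one. -/

section Unshuffles

/-- The permutation of `k + 1` letters that puts `i` first and permutes the remaining letters,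
taken in increasing order, by `τ`. -/
def frontPerm {k : ℕ} (i : Fin (k + 1)) (τ : Equiv.Perm (Fin k)) : Equiv.Perm (Fin (k + 1)) :=
  i.cycleRange.symm * Equiv.Perm.decomposeFin.symm (0, τ)

@[simp] theorem frontPerm_zero {k : ℕ} (i : Fin (k + 1)) (τ : Equiv.Perm (Fin k)) :
    frontPerm i τ 0 = i := by
  simp [frontPerm]

@[simp] theorem frontPerm_succ {k : ℕ} (i : Fin (k + 1)) (τ : Equiv.Perm (Fin k)) (j : Fin k) :
    frontPerm i τ j.succ = i.succAbove (τ j) := by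
  simp [frontPerm]

theorem sign_frontPerm {k : ℕ} (i : Fin (k + 1)) (τ : Equiv.Perm (Fin k)) :
    Equiv.Perm.sign (frontPerm i τ) = (-1) ^ (i : ℕ) * Equiv.Perm.sign τ := by
  simp [frontPerm, Equiv.Perm.sign_symm]

theorem bijective_frontPerm (k : ℕ) :
    Bijective (fun x : Fin (k + 1) × Equiv.Perm (Fin k) => frontPerm x.1 x.2) := by
  rw [Fintype.bijective_iff_injective_and_card]
  constructor
  · rintro ⟨i, τ⟩ ⟨i', τ'⟩ h
    dsimp only at h
    have hi : i = i' := by rw [← frontPerm_zero i τ, h, frontPerm_zero]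
    subst hi
    refine Prod.ext rfl (Equiv.ext fun j => ?_)
    have := congrArg (fun σ => σ j.succ) h
    simpa using this
  · simp [Fintype.card_perm, Nat.factorial_succ]

theorem sum_perm_eq_sum_frontPerm {X : Type*} [AddCommMonoid X] {k : ℕ}
    (F : Equiv.Perm (Fin (k + 1)) → X) : ∑ σ, F σ = ∑ i, ∑ τ, F (frontPerm i τ) := by
  rw [← Fintype.sum_prod_type']
  exact ((bijective_frontPerm k).sum_comp F).symm

theorem strictMono_perm_iff {k : ℕ} (τ : Equiv.Perm (Fin k)) : StrictMono τ ↔ τ = 1 := by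
  refine ⟨fun h => Equiv.ext fun j => ?_, fun h => h ▸ strictMono_id⟩
  have := Subsingleton.elim (h.orderIsoOfSurjective _ τ.surjective) (OrderIso.refl (Fin k))
  exact congrArg (fun e : Fin k ≃o Fin k => e j) this

-- A permutation increasing away from the first position is determined by its first value, since
-- only the identity of `Fin k` is increasing.
open Classical in
theorem sum_perm_strictMono_succ {X : Type*} [AddCommMonoid X] {k : ℕ}
    (F : Equiv.Perm (Fin (k + 1)) → X) :
    ∑ σ : Equiv.Perm (Fin (k + 1)) with StrictMono (fun j : Fin k => σ j.succ), F σ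
      = ∑ i, F (frontPerm i 1) := by
  rw [Finset.sum_filter, sum_perm_eq_sum_frontPerm]
  refine Finset.sum_congr rfl fun i _ => ?_
  have h : ∀ τ : Equiv.Perm (Fin k),
      StrictMono (fun j : Fin k => frontPerm i τ j.succ) ↔ τ = 1 := by
    intro τ
    rw [← strictMono_perm_iff]
    simp only [frontPerm_succ]
    exact ⟨fun h a b hab => (Fin.strictMono_succAbove i).lt_iff_lt.1 (h hab),
      fun h => (Fin.strictMono_succAbove i).comp h⟩
  simp only [h, Finset.sum_ite_eq', Finset.mem_univ, if_true]

-- Two positions are free: `i` is the first value and `j` the place of the second value among those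
-- that remain.
open Classical in
theorem sum_perm_strictMonoOn_succ {X : Type*} [AddCommMonoid X] {k : ℕ}
    (F : Equiv.Perm (Fin (k + 2)) → X) :
    ∑ σ : Equiv.Perm (Fin (k + 2)) with
        StrictMonoOn (fun j : Fin (k + 1) => σ j.succ) {j | 0 < j.val}, F σ
      = ∑ i, ∑ j, F (frontPerm i (frontPerm j 1)) := by
  rw [Finset.sum_filter, sum_perm_eq_sum_frontPerm]
  refine Finset.sum_congr rfl fun i _ => ?_
  rw [← sum_perm_strictMono_succ (fun τ => F (frontPerm i τ)), Finset.sum_filter]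
  refine Finset.sum_congr rfl fun τ _ => ?_
  refine if_congr ?_ rfl rfl
  simp only [frontPerm_succ]
  constructor
  · intro h a b hab
    exact (Fin.strictMono_succAbove i).lt_iff_lt.1
      (h (by simp) (by simp) (Fin.succ_lt_succ_iff.2 hab))
  · intro h a ha b hb hab
    obtain ⟨a, rfl⟩ := Fin.exists_succ_eq.2 (Fin.pos_iff_ne_zero.1 ha)
    obtain ⟨b, rfl⟩ := Fin.exists_succ_eq.2 (Fin.pos_iff_ne_zero.1 hb)
    exact Fin.strictMono_succAbove i (h (Fin.succ_lt_succ_iff.1 hab))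

/-- The permutation of `k + 1` letters that puts `i` last and keeps the order of the others. -/
def backPerm {k : ℕ} (i : Fin (k + 1)) : Equiv.Perm (Fin (k + 1)) :=
  frontPerm i 1 * finRotate (k + 1)

@[simp] theorem backPerm_last {k : ℕ} (i : Fin (k + 1)) : backPerm i (Fin.last k) = i := by
  simp [backPerm]

@[simp] theorem backPerm_castSucc {k : ℕ} (i : Fin (k + 1)) (j : Fin k) :
    backPerm i j.castSucc = i.succAbove j := by
  simp [backPerm]

theorem sign_backPerm {k : ℕ} (i : Fin (k + 1)) :
    Equiv.Perm.sign (backPerm i) = (-1) ^ (k + i : ℕ) := by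
  simp [backPerm, sign_frontPerm, pow_add, mul_comm]

open Classical in
theorem sum_perm_strictMono_castSucc {X : Type*} [AddCommMonoid X] {k : ℕ}
    (F : Equiv.Perm (Fin (k + 1)) → X) :
    ∑ σ : Equiv.Perm (Fin (k + 1)) with StrictMono (fun j : Fin k => σ j.castSucc), F σ
      = ∑ i, F (backPerm i) := by
  have h := sum_perm_strictMono_succ (fun σ => F (σ * finRotate (k + 1)))
  rw [Finset.sum_filter] at h ⊢
  refine Eq.trans ?_ h
  rw [← Equiv.sum_comp (Equiv.mulRight (finRotate (k + 1)))]
  simp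

variable {U X Y Z : Type*} [AddCommGroup X]

/-- For `n = 1` the final block is empty, so an unshuffle is just the choice of the letter put last.
-/
theorem insertSum_one_left {k : ℕ} (P : (Fin 1 → U) → X) (Q : (Fin k → U) → U → U)
    (u : Fin (k + 1) → U) :
    insertSum P Q u = ∑ i : Fin (k + 1),
      (-1 : ℤ) ^ (k + i : ℕ) • P (fun _ => Q (i.removeNth u) (u i)) := by
  classical
  have hset : ∀ σ : Equiv.Perm (Fin (k + 1)),
      σ ∈ unshuffles₁ k 1 ↔ StrictMono (fun j : Fin k => σ j.castSucc) := by
    intro σ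
    refine ⟨fun h => h.2.1, fun h => ⟨one_pos, h, ?_⟩⟩
    intro a ha
    simp at ha
  rw [insertSum]
  simp only [hset]
  rw [sum_perm_strictMono_castSucc]
  refine Finset.sum_congr rfl fun i _ => ?_
  rw [sign_backPerm]
  have h : (fun j : Fin 1 => if j.val = 0 then
      Q (fun l => u (backPerm i (Fin.castAdd 1 l))) (u (backPerm i (Fin.natAdd k j)))
      else u (backPerm i (Fin.natAdd k j))) = fun _ => Q (i.removeNth u) (u i) := by
    funext j
    obtain rfl : j = 0 := Subsingleton.elim _ _
    have h1 : ∀ l : Fin k, Fin.castAdd 1 l = l.castSucc := fun _ => rfl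
    have h2 : Fin.natAdd k (0 : Fin 1) = Fin.last k := rfl
    simp only [h1, h2, backPerm_castSucc, backPerm_last, Fin.val_zero, if_true]
    rfl
  rw [h]
  simp

theorem shuffleSum_one_right {k : ℕ} (β : Z → Y → X) (P : (Fin k → U) → Z) (Q : (Fin 1 → U) → Y)
    (u : Fin (k + 1) → U) :
    shuffleSum β P Q u = ∑ i : Fin (k + 1),
      (-1 : ℤ) ^ (k + i : ℕ) • β (P (i.removeNth u)) (Q fun _ => u i) := by
  classical
  have hset : ∀ σ : Equiv.Perm (Fin (k + 1)),
      σ ∈ unshuffles k 1 ↔ StrictMono (fun j : Fin k => σ j.castSucc) :=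
    fun σ => ⟨fun h => h.1, fun h => ⟨h, Subsingleton.strictMono _⟩⟩
  rw [shuffleSum]
  simp only [hset]
  rw [sum_perm_strictMono_castSucc]
  refine Finset.sum_congr rfl fun i _ => ?_
  rw [sign_backPerm]
  have h1 : (fun l : Fin k => u (backPerm i (Fin.castAdd 1 l))) = i.removeNth u :=
    funext fun l => congrArg u (backPerm_castSucc i l)
  have h2 : (fun j : Fin 1 => u (backPerm i (Fin.natAdd k j))) = fun _ => u i := by
    funext j
    obtain rfl : j = 0 := Subsingleton.elim _ _
    exact congrArg u (backPerm_last i)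
  rw [h1, h2]
  simp

/-- Permutations of `1 + k` letters as permutations of `k + 1` letters. -/
def permOneAdd (k : ℕ) : Equiv.Perm (Fin (k + 1)) ≃ Equiv.Perm (Fin (1 + k)) :=
  (finCongr (add_comm k 1)).permCongr

theorem sign_permOneAdd {k : ℕ} (σ : Equiv.Perm (Fin (k + 1))) :
    Equiv.Perm.sign (permOneAdd k σ) = Equiv.Perm.sign σ :=
  Equiv.Perm.sign_permCongr _ _

theorem permOneAdd_natAdd {k : ℕ} (σ : Equiv.Perm (Fin (k + 1))) (j : Fin k) :
    permOneAdd k σ (Fin.natAdd 1 j) = Fin.cast (add_comm k 1) (σ j.succ) := by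
  simp only [permOneAdd, Equiv.permCongr_apply]
  have : (finCongr (add_comm k 1)).symm (Fin.natAdd 1 j) = j.succ := by
    ext; simp
  rw [this]; rfl

theorem permOneAdd_castAdd {k : ℕ} (σ : Equiv.Perm (Fin (k + 1))) (j : Fin 1) :
    permOneAdd k σ (Fin.castAdd k j) = Fin.cast (add_comm k 1) (σ 0) := by
  simp only [permOneAdd, Equiv.permCongr_apply]
  have : (finCongr (add_comm k 1)).symm (Fin.castAdd k j) = 0 := by
    ext; simp
  rw [this]; rfl

theorem shuffleSum_one_left {k : ℕ} (β : Z → Y → X) (P : (Fin 1 → U) → Z) (Q : (Fin k → U) → Y)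
    (u : Fin (k + 1) → U) :
    shuffleSum β P Q (recast u) = ∑ i : Fin (k + 1),
      (-1 : ℤ) ^ (i : ℕ) • β (P fun _ => u i) (Q (i.removeNth u)) := by
  classical
  rw [shuffleSum, Finset.sum_filter, ← Equiv.sum_comp (permOneAdd k)]
  have hset : ∀ σ : Equiv.Perm (Fin (k + 1)),
      permOneAdd k σ ∈ unshuffles 1 k ↔ StrictMono (fun j : Fin k => σ j.succ) := by
    intro σ
    simp only [unshuffles, Set.mem_ofPred_eq, permOneAdd_natAdd]
    exact ⟨fun h => h.2, fun h => ⟨Subsingleton.strictMono _, h⟩⟩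
  simp only [hset]
  rw [← Finset.sum_filter, sum_perm_strictMono_succ]
  refine Finset.sum_congr rfl fun i _ => ?_
  simp only [permOneAdd_natAdd, permOneAdd_castAdd, sign_permOneAdd,
    sign_frontPerm, recast, Fin.cast_cast, Fin.cast_eq_self, frontPerm_zero, frontPerm_succ,
    Equiv.Perm.one_apply, Equiv.Perm.sign_one, mul_one, Units.val_pow_eq_pow_val, Units.val_neg,
    Units.val_one]
  rfl

variable [AddCommGroup U] [Module ℝ U] [Module ℝ X]

/-- Alternation of `P` turns insertion in the first slot into insertion in place: moving the
inserted value to slot `j` costs `(-1)^j`, which cancels the sign of the inner `frontPerm j 1`. -/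
theorem insertSum_one_right {k : ℕ} (P : U [⋀^Fin k]→ₗ[ℝ] X) (Q : (Fin 1 → U) → U → U)
    (u : Fin (k + 1) → U) :
    insertSum P Q (recast u) = ∑ i : Fin (k + 1), (-1 : ℤ) ^ (i : ℕ) •
      ∑ j, P (Function.update (i.removeNth u) j (Q (fun _ => u i) (i.removeNth u j))) := by
  classical
  cases k with
  | zero =>
    -- The block would have length `-1`: no unshuffles on the left, no slots `j` on the right.
    rw [insertSum, Finset.sum_eq_zero]
    · simp
    · intro σ hσ
      exact absurd (Finset.mem_filter.1 hσ).2.1 (lt_irrefl 0)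
  | succ k =>
  rw [insertSum, Finset.sum_filter, ← Equiv.sum_comp (permOneAdd (k + 1))]
  have hset : ∀ σ : Equiv.Perm (Fin (k + 1 + 1)), permOneAdd (k + 1) σ ∈ unshuffles₁ 1 (k + 1) ↔
      StrictMonoOn (fun j : Fin (k + 1) => σ j.succ) {j | 0 < j.val} := by
    intro σ
    simp only [unshuffles₁, Set.mem_ofPred_eq, permOneAdd_natAdd]
    exact ⟨fun h => h.2.2, fun h => ⟨k.succ_pos, Subsingleton.strictMono _, h⟩⟩
  simp only [hset]
  rw [← Finset.sum_filter, sum_perm_strictMonoOn_succ]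
  refine Finset.sum_congr rfl fun i _ => ?_
  rw [Finset.smul_sum]
  refine Finset.sum_congr rfl fun j _ => ?_
  simp only [permOneAdd_natAdd, permOneAdd_castAdd, sign_permOneAdd,
    sign_frontPerm, recast, Fin.cast_cast, Fin.cast_eq_self, frontPerm_zero, frontPerm_succ]
  have h : (fun l : Fin (k + 1) => if l.val = 0 then
        Q (fun _ => u i) (u (i.succAbove (frontPerm j 1 l)))
      else u (i.succAbove (frontPerm j 1 l)))
      = Matrix.vecCons (Q (fun _ => u i) (i.removeNth u j)) (j.removeNth (i.removeNth u)) := by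
    funext l
    refine Fin.cases ?_ (fun l => ?_) l
    · simp [Fin.removeNth_apply]
    · simp [Fin.removeNth_apply]
  rw [h, ← AlternatingMap.neg_one_pow_smul_map_insertNth P j, Fin.insertNth_removeNth]
  simp only [Equiv.Perm.sign_one, mul_one]
  rcases Nat.even_or_odd (j : ℕ) with hj | hj <;> simp [hj.neg_one_pow]

end Unshuffles

/-! ### Naturality and function-linearity of the Chevalley–Eilenberg differential. -/

section PreLie

variable {R V N N' : Type*} [CommRing R] [AddCommGroup V] [Module R V] [AddCommGroup N]
  [Module R N] [AddCommGroup N'] [Module R N']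
  {mul : V →ₗ[R] Module.End R V} {θ : V →ₗ[R] Module.End R N} {θ' : V →ₗ[R] Module.End R N'}

theorem ceDiff_compAlternatingMap {k : ℕ} (g : N →ₗ[R] N') (P : V [⋀^Fin k]→ₗ[R] N)
    (h : ∀ u w, g (θ u (P w)) = θ' u (g (P w))) :
    ceDiff mul θ' k (g.compAlternatingMap P) = g.compAlternatingMap (ceDiff mul θ k P) := by
  ext u
  simp only [ceDiff_apply, LinearMap.compAlternatingMap_apply, map_sum, map_zsmul, map_sub, h]

theorem ceDiff_mem {k : ℕ} (S : Submodule R N) (P : V [⋀^Fin k]→ₗ[R] N)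
    (hP : ∀ w, P w ∈ S) (hθ : ∀ u, ∀ n ∈ S, θ u n ∈ S) (u : Fin (k + 1) → V) :
    ceDiff mul θ k P u ∈ S := by
  rw [ceDiff_apply]
  exact S.sum_mem fun i _ => zsmul_mem (S.sub_mem (hθ _ _ (hP _))
    (S.sum_mem fun j _ => hP _)) _

/-- The differential `ceDiff` is function-linear: here `fV` and `fN` are the multiplications by a
function `f`, and `gV u` and `gN u` those by the derivative of `f` along the anchor of `u`. -/
theorem ceDiff_update {k : ℕ} (P : V [⋀^Fin k]→ₗ[R] N)
    (fV : V →ₗ[R] V) (fN : N →ₗ[R] N) (gV : V → V → V) (gN : V → N → N)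
    (mul_left : ∀ u w, mul (fV u) w = fV (mul u w))
    (mul_right : ∀ u w, mul u (fV w) = fV (mul u w) + gV u w)
    (act_left : ∀ u w, θ (fV u) (P w) = fN (θ u (P w)))
    (act_right : ∀ u w, θ u (fN (P w)) = fN (θ u (P w)) + gN u (P w))
    (hf : ∀ w i, P (update w i (fV (w i))) = fN (P w))
    (hg : ∀ u w i, P (update w i (gV u (w i))) = gN u (P w))
    (u : Fin (k + 1) → V) (i : Fin (k + 1)) :
    ceDiff mul θ k P (update u i (fV (u i))) = fN (ceDiff mul θ k P u) := by
  have hf' : ∀ w i x, P (update w i (fV x)) = fN (P (update w i x)) := by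
    intro w i x
    have := hf (update w i x) i
    rwa [update_self, update_idem] at this
  have left : ∀ v w, covDeriv mul θ k (fV v) P w = fN (covDeriv mul θ k v P w) := by
    intro v w
    simp only [covDeriv_apply, mul_left, act_left, hf', map_sub, map_sum]
  -- The term `gN` from the Leibniz rule of `θ v` cancels the term `gV` from the product in slot
  -- `i`, by `hg`. So `∇P` is already function-linear before alternation.
  have right : ∀ v w i, covDeriv mul θ k v P (update w i (fV (w i)))
      = fN (covDeriv mul θ k v P w) := by
    intro v w i
    simp only [covDeriv_apply, hf, act_right, map_sub, map_sum]
    rw [← Finset.add_sum_erase _ _ (Finset.mem_univ i),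
      ← Finset.add_sum_erase _ (fun j => fN (P (update w j (mul v (w j))))) (Finset.mem_univ i),
      update_self, update_idem, mul_right, P.map_update_add, hf', hg]
    have : ∀ j ∈ Finset.univ.erase i,
        P (update (update w i (fV (w i))) j (mul v (update w i (fV (w i)) j)))
          = fN (P (update w j (mul v (w j)))) := by
      intro j hj
      have hji := (Finset.mem_erase.1 hj).1
      rw [update_of_ne hji, update_comm hji.symm, hf']
      congr 2
      rw [update_eq_self_iff, update_of_ne hji.symm]
    rw [Finset.sum_congr rfl this]
    abel
  rw [ceDiff, AlternatingMap.alternatizeUncurryFin_apply,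
    AlternatingMap.alternatizeUncurryFin_apply, map_sum]
  refine Finset.sum_congr rfl fun l _ => ?_
  rw [map_zsmul]
  congr 1
  simp only [LinearMap.flip_apply]
  rcases eq_or_ne i l with rfl | h
  · rw [update_self, Fin.removeNth_update, left]
  · obtain ⟨j, rfl⟩ := Fin.exists_succAbove_eq h
    rw [update_of_ne h.symm, Fin.removeNth_update_succAbove]
    exact right _ (l.removeNth u) j

end PreLie

/-! ### Function-linear operators on sections are pointwise. -/

section Geometry

variable {B : Type*} [NormedAddCommGroup B] [NormedSpace ℝ B] {H : Type*} [TopologicalSpace H]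
  {I : ModelWithCorners ℝ B H} {M : Type*} [TopologicalSpace M] [ChartedSpace H M]
  {F : Type*} [NormedAddCommGroup F] [NormedSpace ℝ F]
  {V : M → Type*} [TopologicalSpace (TotalSpace F V)] [∀ x, AddCommGroup (V x)]
  [∀ x, Module ℝ (V x)] [∀ x, TopologicalSpace (V x)] [FiberBundle F V] [VectorBundle ℝ F V]

@[simp] theorem fsmul_apply (f : C^∞⟮I, M; ℝ⟯) (s : Sec I F V) (x : M) :
    fsmul f s x = f x • s x := rfl

/-- Multiplication by a function as a linear map on sections. -/
def fsmulHom (f : C^∞⟮I, M; ℝ⟯) : Sec I F V →ₗ[ℝ] Sec I F V where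
  toFun := fsmul f
  map_add' s t := by ext x; simp
  map_smul' c s := by ext x; exact smul_comm (f x) c (s x)

@[simp] theorem fsmulHom_apply (f : C^∞⟮I, M; ℝ⟯) (s : Sec I F V) :
    fsmulHom f s = fsmul f s := rfl

variable {F' : Type*} [NormedAddCommGroup F'] [NormedSpace ℝ F']
  {W : M → Type*} [TopologicalSpace (TotalSpace F' W)] [∀ x, AddCommGroup (W x)]
  [∀ x, Module ℝ (W x)] [∀ x, TopologicalSpace (W x)] [FiberBundle F' W] [VectorBundle ℝ F' W]

theorem exists_alternatingMap_of_mem_cochains {k : ℕ} {P : Op I F' W F V k}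
    (hP : P ∈ cochains I F' W F V k) :
    ∃ P' : Sec I F V [⋀^Fin k]→ₗ[ℝ] Sec I F' W, ∀ u, P u = P' u := by
  obtain ⟨φ, hφ⟩ := hP
  have hup : ∀ [DecidableEq (Fin k)] (u : Fin k → Sec I F V) i (x : Sec I F V) p,
      (fun j => update u i x j p) = update (fun j => u j p) i (x p) := by
    intro _ u i x p
    ext j
    rcases eq_or_ne j i with rfl | h
    · simp
    · simp [h]
  refine ⟨⟨⟨P, ?_, ?_⟩, ?_⟩, fun _ => rfl⟩
  · intro _ u i x y
    ext p
    simp only [ContMDiffSection.coe_add, Pi.add_apply, hφ, hup, AlternatingMap.map_update_add]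
  · intro _ u i a x
    ext p
    simp only [ContMDiffSection.coe_smul, Pi.smul_apply, hφ, hup, AlternatingMap.map_update_smul]
  · intro u i j h hij
    ext p
    exact (hφ u p).trans ((φ p).map_eq_zero_of_eq _ (by simp only [h]) hij)

theorem update_fsmul_of_mem_cochains {k : ℕ} {P : Op I F' W F V k}
    (hP : P ∈ cochains I F' W F V k) (f : C^∞⟮I, M; ℝ⟯) (u : Fin k → Sec I F V) (i : Fin k) :
    P (update u i (fsmul f (u i))) = fsmul f (P u) := by
  obtain ⟨φ, hφ⟩ := hP
  ext p
  have hup : (fun j => update u i (fsmul f (u i)) j p)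
      = update (fun j => u j p) i (f p • u i p) := by
    ext j
    rcases eq_or_ne j i with rfl | h
    · simp
    · simp [h]
  rw [fsmul_apply, hφ, hφ, hup, AlternatingMap.map_update_smul, update_eq_self]

theorem exists_frame [FiniteDimensional ℝ B] [T2Space M] [IsManifold I ∞ M]
    [FiniteDimensional ℝ F] [ContMDiffVectorBundle ∞ F V I] (p : M) :
    ∃ (n : ℕ) (S : Fin n → Sec I F V) (l : Fin n → V p →ₗ[ℝ] ℝ)
      (c : Fin n → Sec I F V → C^∞⟮I, M; ℝ⟯) (χ : C^∞⟮I, M; ℝ⟯), χ p = 1 ∧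
      (∀ s, fsmul χ s = ∑ i, fsmul (c i s) (S i)) ∧ (∀ i s, c i s p = l i (s p)) ∧
      ∀ v, v = ∑ i, l i v • S i p := by
  have : ContMDiffVectorBundle 1 F V I := ContMDiffVectorBundle.of_le (n := ∞) (by simp)
  let e := trivializationAt F V p
  have hp : p ∈ e.baseSet := FiberBundle.mem_baseSet_trivializationAt F V p
  obtain ⟨ψ, hψ, -⟩ := (SmoothBumpFunction.nhds_basis_support (I := I)
    (e.open_baseSet.mem_nhds hp)).mem_iff.1 (e.open_baseSet.mem_nhds hp)
  let b := Module.finBasis ℝ F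
  let ψ' : C^∞⟮I, M; ℝ⟯ := ⟨ψ, ψ.contMDiff⟩
  have hψp : ψ p = 1 := ψ.eq_one
  let S : Fin (Module.finrank ℝ F) → Sec I F V := fun i =>
    ⟨(ψ : M → ℝ) • e.localFrame b i, ContMDiffOn.smul_section_of_tsupport ψ.contMDiff.contMDiffOn
      e.open_baseSet hψ (e.contMDiffOn_localFrame_baseSet ∞ b i)⟩
  let c : Fin (Module.finrank ℝ F) → Sec I F V → C^∞⟮I, M; ℝ⟯ := fun i s =>
    ⟨fun x => ψ x * e.localFrameCoeff I b i x (s x), by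
      refine contMDiff_of_tsupport fun x hx => ?_
      refine ContMDiffAt.mul (ψ.contMDiff x) ?_
      exact contMDiffAt_localFrameCoeff b (hψ (tsupport_mul_subset_left hx)) (s.contMDiff x) i⟩
  have hS : ∀ i x, S i x = ψ x • e.localFrame b i x := fun _ _ => rfl
  have hc : ∀ i s x, c i s x = ψ x * e.localFrameCoeff I b i x (s x) := fun _ _ _ => rfl
  -- `χ = ψ²`: one factor of the bump function extends the frame by zero, the other extends the
  -- coefficients.
  refine ⟨_, S, fun i => e.localFrameCoeff I b i p, c, ψ' * ψ', ?_, ?_, ?_, ?_⟩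
  · change ψ p * ψ p = 1
    simp
  · intro s
    ext x
    rw [← ContMDiffSection.coeAddHom_apply (∑ i, _), map_sum, Finset.sum_apply]
    simp only [ContMDiffSection.coeAddHom_apply, fsmul_apply, hS, hc]
    change (ψ x * ψ x) • s x = _
    by_cases hx : x ∈ e.baseSet
    · conv_lhs => rw [e.eq_sum_localFrameCoeff_smul (I := I) (b := b) (s := s) hx]
      rw [Finset.smul_sum]
      refine Finset.sum_congr rfl fun i _ => ?_
      rw [smul_smul, smul_smul]
      ring_nf
    · have : ψ x = 0 := image_eq_zero_of_notMem_tsupport fun h => hx (hψ h)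
      simp [this]
  · intro i s
    rw [hc, hψp, one_mul]
  · classical
    intro v
    have h := e.eq_sum_localFrameCoeff_smul (I := I) (b := b) (s := Function.update 0 p v) hp
    simp only [update_self] at h
    simpa [hS, hψp] using h

variable [FiniteDimensional ℝ B] [T2Space M] [IsManifold I ∞ M]
    [FiniteDimensional ℝ F] [ContMDiffVectorBundle ∞ F V I]

/-- `Q s = χ(p) Q s = Q(χ s) = ∑ c_i(s)(p) Q(S_i)`, and the coefficients vanish at `p` with `s`. -/
theorem eq_zero_of_tensorial {p : M} {W : Type*} [AddCommGroup W] [Module ℝ W]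
    (Q : Sec I F V →ₗ[ℝ] W) (hQ : ∀ f s, Q (fsmul f s) = (f p : ℝ) • Q s) {s : Sec I F V}
    (hs : s p = 0) : Q s = 0 := by
  obtain ⟨n, S, l, c, χ, hχ, h, hc, -⟩ := exists_frame (I := I) (F := F) (V := V) p
  have := hQ χ s
  rw [hχ, one_smul, h, map_sum] at this
  rw [← this]
  simp [hQ, hc, hs]

theorem exists_linear_extension (p : M) :
    ∃ ext : V p →ₗ[ℝ] Sec I F V, ∀ v, ext v p = v := by
  obtain ⟨n, S, l, c, χ, hχ, h, hc, hl⟩ := exists_frame (I := I) (F := F) (V := V) p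
  refine ⟨∑ i, (l i).smulRight (S i), fun v => ?_⟩
  rw [LinearMap.sum_apply, ← ContMDiffSection.coeAddHom_apply (∑ i, _), map_sum, Finset.sum_apply]
  conv_rhs => rw [hl v]
  rfl

theorem mem_cochains_of_update_fsmul {k : ℕ} (P : Sec I F V [⋀^Fin k]→ₗ[ℝ] Sec I F' W)
    (hP : ∀ (f : C^∞⟮I, M; ℝ⟯) u i, P (update u i (fsmul f (u i))) = fsmul f (P u)) :
    (fun u => P u) ∈ cochains I F' W F V k := by
  choose ext hext using fun p => exists_linear_extension (I := I) (F := F) (V := V) p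
  let ev : ∀ p, Sec I F' W →ₗ[ℝ] W p := fun p =>
    { toFun := fun s => s p, map_add' := fun _ _ => rfl, map_smul' := fun _ _ => rfl }
  refine ⟨fun p => ((ev p).compAlternatingMap P).compLinearMap (ext p), fun u p => ?_⟩
  have hzero : ∀ (w : Fin k → Sec I F V) i (x : Sec I F V), x p = 0 → P (update w i x) p = 0 := by
    intro w i x hx
    refine eq_zero_of_tensorial ((ev p).comp (P.toMultilinearMap.toLinearMap w i)) ?_ hx
    intro f s
    have := hP f (update w i s) i
    rw [update_self, update_idem] at this
    exact congrArg (fun t : Sec I F' W => t p) this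
  -- Arguments are replaced one at a time by the chosen extension of their value at `p`; each
  -- difference vanishes at `p`.
  have key : ∀ t : Finset (Fin k), P u p = P (t.piecewise (fun i => ext p (u i p)) u) p := by
    intro t
    induction t using Finset.induction_on with
    | empty => simp
    | insert a t ha ih =>
      rw [ih, Finset.piecewise_insert, ← sub_eq_zero]
      have h := hzero (t.piecewise (fun i => ext p (u i p)) u) a (u a - ext p (u a p))
        (by simp [hext])
      rw [P.map_update_sub] at h
      have h2 : update (t.piecewise (fun i => ext p (u i p)) u) a (u a)
          = t.piecewise (fun i => ext p (u i p)) u := by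
        rw [update_eq_self_iff]; simp [ha]
      rw [h2] at h
      exact h
  have := key Finset.univ
  rw [Finset.piecewise_univ] at this
  exact this

end Geometry

/-! ### Lie bracket of smooth vector fields and its action on functions. -/

section VectorFields

variable {B : Type*} [NormedAddCommGroup B] [NormedSpace ℝ B] {H : Type*} [TopologicalSpace H]
  {I : ModelWithCorners ℝ B H} {M : Type*} [TopologicalSpace M] [ChartedSpace H M]
  [IsManifold I ∞ M]

variable (I M) in
/-- Smooth vector fields. -/
abbrev VField : Type _ := Sec I B (TangentSpace I : M → Type _)

/-- The derivative `X(f)` as a smooth function. -/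
def lieDeriv (X : VField I M) (f : C^∞⟮I, M; ℝ⟯) : C^∞⟮I, M; ℝ⟯ :=
  ⟨dirDeriv X f, by
    have : IsManifold I 1 M := IsManifold.of_le (n := ∞) (by simp)
    have h := (contMDiff_snd_tangentBundle_modelSpace ℝ 𝓘(ℝ, ℝ)).comp
      ((f.contMDiff.contMDiff_tangentMap (m := ∞) (by simp)).comp X.contMDiff)
    exact h⟩

@[simp] theorem lieDeriv_apply (X : VField I M) (f : C^∞⟮I, M; ℝ⟯) (p : M) :
    lieDeriv X f p = dirDeriv X f p := rfl

variable [CompleteSpace B]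

/-- The Lie bracket of smooth vector fields. -/
def vfBracket : VField I M →ₗ[ℝ] VField I M →ₗ[ℝ] VField I M :=
  have : IsManifold I (minSmoothness ℝ 2) M := by
    rw [minSmoothness_of_isRCLikeNormedField]
    exact IsManifold.of_le (n := ∞) (by norm_cast)
  LinearMap.mk₂ ℝ (fun X Y => ⟨VectorField.mlieBracket I X Y, by
      have : IsManifold I (∞ + 1) M := by simpa using! (inferInstance : IsManifold I ∞ M)
      exact ContDiff.mlieBracket_vectorField (m := ⊤) (n := ⊤) X.contMDiff Y.contMDiff
        (by simp [minSmoothness_of_isRCLikeNormedField])⟩)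
    (by
      intro X X' Y; ext p
      exact VectorField.mlieBracket_add_left X.mdifferentiableAt X'.mdifferentiableAt)
    (by
      intro c X Y; ext p
      exact VectorField.mlieBracket_const_smul_left X.mdifferentiableAt)
    (by
      intro X Y Y'; ext p
      exact VectorField.mlieBracket_add_right Y.mdifferentiableAt Y'.mdifferentiableAt)
    (by
      intro c X Y; ext p
      exact VectorField.mlieBracket_const_smul_right Y.mdifferentiableAt)

theorem vfBracket_swap (X Y : VField I M) : vfBracket X Y = -vfBracket Y X := by
  ext p
  exact VectorField.mlieBracket_swap_apply

theorem vfBracket_fsmul_right (X Y : VField I M) (f : C^∞⟮I, M; ℝ⟯) :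
    vfBracket X (fsmul f Y) = fsmul f (vfBracket X Y) + fsmul (lieDeriv X f) Y := by
  ext p
  have := VectorField.mlieBracket_smul_right (I := I) (V := X) (W := Y) (x := p)
    (f.contMDiff.mdifferentiableAt (by simp)) Y.mdifferentiableAt
  exact this.trans (add_comm _ _)

theorem vfBracket_fsmul_left (X Y : VField I M) (f : C^∞⟮I, M; ℝ⟯) :
    vfBracket (fsmul f X) Y = fsmul f (vfBracket X Y) - fsmul (lieDeriv Y f) X := by
  rw [vfBracket_swap, vfBracket_fsmul_right, vfBracket_swap X Y]
  ext p
  simp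
  abel

theorem vfBracket_leibniz (X Y Z : VField I M) :
    vfBracket X (vfBracket Y Z) = vfBracket (vfBracket X Y) Z + vfBracket Y (vfBracket X Z) := by
  have : IsManifold I (minSmoothness ℝ 3) M := by
    rw [minSmoothness_of_isRCLikeNormedField]
    exact IsManifold.of_le (n := ∞) (by norm_cast)
  have h2 : minSmoothness ℝ 2 ≤ ∞ := by
    rw [minSmoothness_of_isRCLikeNormedField]; norm_cast
  ext p
  exact VectorField.leibniz_identity_mlieBracket_apply (X.contMDiff.of_le h2 p)
    (Y.contMDiff.of_le h2 p) (Z.contMDiff.of_le h2 p)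

/-- Compare the Jacobi identity for `X, Y, fZ` with `f` times that for `X, Y, Z`: what is left is
the claimed identity multiplied by `Z p`. -/
theorem dirDeriv_vfBracket [FiniteDimensional ℝ B] [T2Space M] (X Y : VField I M)
    (f : C^∞⟮I, M; ℝ⟯) (p : M) : dirDeriv (vfBracket X Y) f p
      = dirDeriv X (lieDeriv Y f) p - dirDeriv Y (lieDeriv X f) p := by
  have key : ∀ Z : VField I M, (dirDeriv (vfBracket X Y) f p
      - (dirDeriv X (lieDeriv Y f) p - dirDeriv Y (lieDeriv X f) p)) • Z p = 0 := by
    intro Z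
    have h := vfBracket_leibniz X Y (fsmul f Z)
    simp only [vfBracket_fsmul_right, map_add] at h
    have hZ := vfBracket_leibniz X Y Z
    rw [hZ] at h
    have hp := congrArg (fun s : VField I M => s p) h
    simp only [ContMDiffSection.coe_add, Pi.add_apply, fsmul_apply, lieDeriv_apply, smul_add]
      at hp
    rw [sub_smul, sub_smul, ← sub_eq_zero.2 hp.symm]
    abel
  obtain ⟨ext, hext⟩ := exists_linear_extension (I := I) (F := B)
    (V := (TangentSpace I : M → Type _)) p
  -- `Z p` can be any tangent vector, so failure would force the tangent space at `p` to be zero;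
  -- then all the derivatives vanish anyway.
  by_contra hne
  have hz : ∀ v : TangentSpace I p, v = 0 := by
    intro v
    have := key (ext v)
    rw [hext] at this
    exact (smul_eq_zero.1 this).resolve_left (sub_ne_zero.2 hne)
  apply hne
  simp only [dirDeriv]
  rw [hz (vfBracket X Y p), hz (X p), hz (Y p)]
  simp

end VectorFields

/-! ### The two differentials as Chevalley–Eilenberg differentials. -/

section Complexes

variable {B : Type*} [NormedAddCommGroup B] [NormedSpace ℝ B] {H : Type*} [TopologicalSpace H]
  {I : ModelWithCorners ℝ B H} {M : Type*} [TopologicalSpace M] [ChartedSpace H M]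
  [IsManifold I ∞ M]
  {FA : Type*} [NormedAddCommGroup FA] [NormedSpace ℝ FA]
  {A : M → Type*} [TopologicalSpace (TotalSpace FA A)] [∀ x, AddCommGroup (A x)]
  [∀ x, Module ℝ (A x)] [∀ x, TopologicalSpace (A x)] [FiberBundle FA A] [VectorBundle ℝ FA A]
  [∀ x, IsTopologicalAddGroup (A x)] [∀ x, ContinuousSMul ℝ (A x)]
  {FE : Type*} [NormedAddCommGroup FE] [NormedSpace ℝ FE]
  {E : M → Type*} [TopologicalSpace (TotalSpace FE E)] [∀ x, AddCommGroup (E x)]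
  [∀ x, Module ℝ (E x)] [∀ x, TopologicalSpace (E x)] [FiberBundle FE E] [VectorBundle ℝ FE E]

theorem BundleMap.onSec_fsmul (T : BundleMap I FE E FA A) (f : C^∞⟮I, M; ℝ⟯) (s : Sec I FE E) :
    T.onSec (fsmul f s) = fsmul f (T.onSec s) := by
  ext p
  exact map_smul (T p) (f p) (s p)

theorem LieAlgebroid.bracket_swap (𝒜 : LieAlgebroid I FA A) (x y : Sec I FA A) :
    𝒜.bracket x y = -𝒜.bracket y x := by
  have h := 𝒜.bracket_self (x + y)
  simp only [map_add, LinearMap.add_apply, 𝒜.bracket_self, zero_add, add_zero] at h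
  exact eq_neg_of_add_eq_zero_right h

theorem LieAlgebroid.bracket_bracket (𝒜 : LieAlgebroid I FA A) (x y z : Sec I FA A) :
    𝒜.bracket (𝒜.bracket x y) z
      = 𝒜.bracket x (𝒜.bracket y z) - 𝒜.bracket y (𝒜.bracket x z) := by
  have h := 𝒜.jacobi x y z
  rw [𝒜.bracket_swap z (𝒜.bracket x y), 𝒜.bracket_swap z x, map_neg] at h
  rw [eq_comm, ← sub_eq_zero, ← h]
  abel

variable {𝒜 : LieAlgebroid I FA A} (ρ : Representation FE E 𝒜) (T : BundleMap I FE E FA A)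

/-- The representation `θ(u) x = [T u, x] + T(ρ(x) u)` on `Γ(A)` of the sub-adjacent Lie algebra
of the pre-Lie algebra `(Γ(E), ∗_T)`. -/
def actT : Sec I FE E →ₗ[ℝ] Module.End ℝ (Sec I FA A) :=
  LinearMap.mk₂ ℝ (fun u x => 𝒜.bracket (T.onSec u) x + T.onSec (ρ.act x u))
    (by intros; simp only [map_add, LinearMap.add_apply]; abel)
    (by intros; simp only [map_smul, LinearMap.smul_apply, smul_add])
    (by intros; simp only [map_add, LinearMap.add_apply]; abel)
    (by intros; simp only [map_smul, LinearMap.smul_apply, smul_add])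

@[simp] theorem actT_apply (u : Sec I FE E) (x : Sec I FA A) :
    actT ρ T u x = 𝒜.bracket (T.onSec u) x + T.onSec (ρ.act x u) := rfl

variable {T} in
-- Jacobi handles the double brackets; the Rota–Baxter identity, applied also to `[Tu, T(ρ(x)v)]`,
-- and the bracket rule for `ρ` handle the terms in the image of `T`.
theorem actT_commutator (hT : IsRelRotaBaxter ρ T) (u v : Sec I FE E) (x : Sec I FA A) :
    actT ρ T (ρ.act (T.onSec u) v - ρ.act (T.onSec v) u) x
      = actT ρ T u (actT ρ T v x) - actT ρ T v (actT ρ T u x) := by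
  simp only [actT_apply]
  rw [← hT u v, 𝒜.bracket_bracket]
  simp only [map_add, hT _ _, ρ.act_bracket, LinearMap.add_apply, map_sub]
  abel

theorem dT_alternatingMap {k : ℕ} (P : Sec I FE E [⋀^Fin k]→ₗ[ℝ] Sec I FA A) :
    dT ρ T k (fun u => P u) = fun u => ceDiff (ρ.act ∘ₗ T.onSec) (actT ρ T) k P u := by
  funext u
  change (-1 : ℝ) ^ k • (insertSum (asCochain T) (Phi ρ k P) u
    - (-1 : ℝ) ^ (k * 1) • insertSum P (Phi ρ 1 (asCochain T)) (recast u)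
    + (-1 : ℝ) ^ (k * 1) • shuffleSum (fun x y => 𝒜.bracket x y) (asCochain T) P (recast u)) = _
  rw [insertSum_one_left, insertSum_one_right, shuffleSum_one_left, ceDiff_apply, mul_one,
    Finset.smul_sum, Finset.smul_sum, ← Finset.sum_sub_distrib, ← Finset.sum_add_distrib,
    Finset.smul_sum]
  refine Finset.sum_congr rfl fun i _ => ?_
  simp only [asCochain, Phi, LinearMap.coe_mk, AddHom.coe_mk, actT_apply, LinearMap.comp_apply,
    pow_add]
  rcases Nat.even_or_odd k with hk | hk <;> rcases Nat.even_or_odd (i : ℕ) with hi | hi <;>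
    simp [hk.neg_one_pow, hi.neg_one_pow] <;> abel

variable (L : LeftSymmetricAlgebroid I FE E)

/-- The action `Θ(u) φ = [L_u, φ] + L_{φ(u)}` of the sub-adjacent Lie algebra of a left-symmetric
algebroid on the endomorphisms of its space of sections. -/
def actDef : Sec I FE E →ₗ[ℝ] Module.End ℝ (Module.End ℝ (Sec I FE E)) :=
  LinearMap.mk₂ ℝ (fun u φ => L.mul u * φ - φ * L.mul u + L.mul (φ u))
    (by intros; simp only [map_add, add_mul, mul_add]; abel)
    (by intros; simp only [map_smul, smul_mul_assoc, mul_smul_comm, smul_add, smul_sub])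
    (by intros; simp only [LinearMap.add_apply, map_add, add_mul, mul_add]; abel)
    (by
      intros
      simp only [LinearMap.smul_apply, map_smul, smul_mul_assoc, mul_smul_comm, smul_add,
        smul_sub])

theorem actDef_apply (u v : Sec I FE E) (φ : Module.End ℝ (Sec I FE E)) :
    actDef L u φ v = L.mul u (φ v) - φ (L.mul u v) + L.mul (φ u) v := rfl

/-- Left symmetry enters three times: for `(u, v, w)` under `φ`, for `(u, v, φ w)`, and, as `e`, to
rewrite products by `a ∗ φ b`. -/
theorem actDef_commutator (u v : Sec I FE E) (φ : Module.End ℝ (Sec I FE E)) :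
    actDef L (L.mul u v - L.mul v u) φ
      = actDef L u (actDef L v φ) - actDef L v (actDef L u φ) := by
  have h : ∀ u v w, L.mul (L.mul u v) w - L.mul (L.mul v u) w
      = L.mul u (L.mul v w) - L.mul v (L.mul u w) := by
    intro u v w
    rw [← sub_eq_zero, ← sub_eq_zero.2 (L.left_symm v u w)]
    abel
  ext1 w
  have e : ∀ a b : Sec I FE E, L.mul (L.mul a (φ b)) w
      = L.mul (L.mul (φ b) a) w + L.mul a (L.mul (φ b) w) - L.mul (φ b) (L.mul a w) := by
    intro a b
    rw [← sub_eq_zero, ← sub_eq_zero.2 (h a (φ b) w)]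
    abel
  have h1 := congrArg φ (h u v w)
  have h2 := h u v (φ w)
  rw [map_sub, map_sub, sub_eq_sub_iff_add_eq_add] at h1
  rw [sub_eq_sub_iff_add_eq_add] at h2
  simp only [actDef_apply, LinearMap.sub_apply, map_sub, map_add, LinearMap.add_apply, e]
  rw [← sub_eq_zero] at h1 h2 ⊢
  rw [← sub_eq_zero.2 (h2.trans h1.symm)]
  abel

theorem dDef_alternatingMap {k : ℕ} (D : Sec I FE E [⋀^Fin k]→ₗ[ℝ] Module.End ℝ (Sec I FE E)) :
    dDef L k (fun u v => D u v) = fun u v => ceDiff L.mul (actDef L) k D u v := by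
  funext u v
  -- The four sums give, in order, `L_{φ(u)}`, `L_u φ`, the products inside the arguments of `D`,
  -- and `φ L_u`. Fixing `v` makes the third an insertion into an alternating map.
  change (-1 : ℝ) ^ k • ((insertSum (fun w => L.asDer w v) (fun u v => D u v) u
      + (-1 : ℝ) ^ (k * 1) • shuffleSum (fun (d : Sec I FE E → Sec I FE E) w => d w)
        L.asDer (fun w => D w v) (recast u))
    - (-1 : ℝ) ^ (k * 1) • (insertSum (fun w => ((LinearMap.applyₗ v).compAlternatingMap D) w)
        L.asDer (recast u)
      + (-1 : ℝ) ^ (1 * k) • shuffleSum (fun (d : Sec I FE E → Sec I FE E) w => d w)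
        (fun u v => D u v) (fun w => L.asDer w v) u)) = _
  rw [insertSum_one_left, insertSum_one_right, shuffleSum_one_left, shuffleSum_one_right,
    ceDiff_apply, mul_one, one_mul, LinearMap.sum_apply,
    Finset.smul_sum, Finset.smul_sum, ← Finset.sum_add_distrib, ← Finset.sum_add_distrib,
    Finset.smul_sum, ← Finset.sum_sub_distrib, Finset.smul_sum]
  refine Finset.sum_congr rfl fun i _ => ?_
  simp only [LeftSymmetricAlgebroid.asDer, actDef_apply, pow_add,
    LinearMap.compAlternatingMap_apply, LinearMap.applyₗ_apply_apply, LinearMap.smul_apply,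
    LinearMap.sub_apply, LinearMap.sum_apply]
  rcases Nat.even_or_odd k with hk | hk <;> rcases Nat.even_or_odd (i : ℕ) with hi | hi <;>
    simp [hk.neg_one_pow, hi.neg_one_pow] <;> abel

end Complexes

/-! ### Operators paired with their symbols. -/

section Symbols

variable {B : Type*} [NormedAddCommGroup B] [NormedSpace ℝ B] {H : Type*} [TopologicalSpace H]
  {I : ModelWithCorners ℝ B H} {M : Type*} [TopologicalSpace M] [ChartedSpace H M]
  [IsManifold I ∞ M]
  {FE : Type*} [NormedAddCommGroup FE] [NormedSpace ℝ FE]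
  {E : M → Type*} [TopologicalSpace (TotalSpace FE E)] [∀ x, AddCommGroup (E x)]
  [∀ x, Module ℝ (E x)] [∀ x, TopologicalSpace (E x)] [FiberBundle FE E] [VectorBundle ℝ FE E]
  (L : LeftSymmetricAlgebroid I FE E)

theorem LeftSymmetricAlgebroid.mul_fsmul (u v : Sec I FE E) (f : C^∞⟮I, M; ℝ⟯) :
    L.mul u (fsmul f v) = fsmul f (L.mul u v) + fsmul (lieDeriv (L.anchor.onSec u) f) v := by
  ext p
  exact L.mul_leibniz u v f p

variable (I FE E) in
/-- Pairs of an endomorphism of `Γ(E)` and a vector field that is its symbol. -/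
def symbolPairs : Submodule ℝ (Module.End ℝ (Sec I FE E) × VField I M) where
  carrier := {x | ∀ (f : C^∞⟮I, M; ℝ⟯) v,
    x.1 (fsmul f v) = fsmul f (x.1 v) + fsmul (lieDeriv x.2 f) v}
  zero_mem' := by
    intro f v
    ext p
    simp [dirDeriv]
  add_mem' := by
    intro x y hx hy f v
    ext p
    simp only [Prod.fst_add, Prod.snd_add, LinearMap.add_apply, hx f v, hy f v, fsmul_apply,
      ContMDiffSection.coe_add, Pi.add_apply, lieDeriv_apply, dirDeriv, map_add, add_smul, smul_add]
    abel
  smul_mem' := by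
    intro c x hx f v
    ext p
    simp only [Prod.smul_fst, Prod.smul_snd, LinearMap.smul_apply, hx f v, fsmul_apply,
      ContMDiffSection.coe_add, ContMDiffSection.coe_smul, Pi.add_apply, Pi.smul_apply,
      lieDeriv_apply, dirDeriv, map_smul, smul_add, smul_assoc, smul_comm c]

theorem mem_symbolPairs {x : Module.End ℝ (Sec I FE E) × VField I M} :
    x ∈ symbolPairs I FE E ↔ ∀ (f : C^∞⟮I, M; ℝ⟯) v,
      x.1 (fsmul f v) = fsmul f (x.1 v) + fsmul (lieDeriv x.2 f) v := Iff.rfl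

variable (I FE E) in
/-- Multiplication of pairs of endomorphisms and symbols by a function. -/
def fsmulPair (f : C^∞⟮I, M; ℝ⟯) :
    (Module.End ℝ (Sec I FE E) × VField I M) →ₗ[ℝ] (Module.End ℝ (Sec I FE E) × VField I M) :=
  (LinearMap.mulLeft ℝ (fsmulHom f : Module.End ℝ (Sec I FE E))).prodMap (fsmulHom f)

theorem fsmulPair_apply (f : C^∞⟮I, M; ℝ⟯) (x : Module.End ℝ (Sec I FE E) × VField I M) :
    fsmulPair I FE E f x = ((fsmulHom f : Module.End ℝ (Sec I FE E)) * x.1, fsmul f x.2) := rfl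

variable [CompleteSpace B]

/-- The extension of `actDef` to pairs of endomorphisms and symbols,
`Θ(u)(φ, X) = ([L_u, φ] + L_{φ(u)}, [a u, X] + a(φ u))`. -/
def actSymbol : Sec I FE E →ₗ[ℝ] Module.End ℝ (Module.End ℝ (Sec I FE E) × VField I M) :=
  LinearMap.mk₂ ℝ (fun u x =>
      (actDef L u x.1, vfBracket (L.anchor.onSec u) x.2 + L.anchor.onSec (x.1 u)))
    (by intros; ext1 <;> simp only [map_add, LinearMap.add_apply, Prod.mk_add_mk]; abel)
    (by
      intros
      ext1 <;> simp only [map_smul, LinearMap.smul_apply, Prod.smul_mk, smul_add])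
    (by
      intros
      ext1 <;> simp only [map_add, LinearMap.add_apply, Prod.mk_add_mk, Prod.fst_add,
        Prod.snd_add]
      abel)
    (by
      intros
      ext1 <;> simp only [map_smul, LinearMap.smul_apply, Prod.smul_mk, smul_add, Prod.smul_fst,
        Prod.smul_snd])

theorem actSymbol_apply (u : Sec I FE E) (x : Module.End ℝ (Sec I FE E) × VField I M) :
    actSymbol L u x
      = (actDef L u x.1, vfBracket (L.anchor.onSec u) x.2 + L.anchor.onSec (x.1 u)) := rfl

/-- For a pair `(φ, X)`, moving `φ` past `f` in `[f L_u, φ]` gives `-X(f) L_u`, and `L_{φ(fu)}`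
gives `+X(f) L_u`. The vector field component cancels in the same way. The Leibniz rule of the pair
is essential here. -/
theorem actSymbol_fsmul_left (f : C^∞⟮I, M; ℝ⟯) (u : Sec I FE E)
    {x : Module.End ℝ (Sec I FE E) × VField I M} (hx : x ∈ symbolPairs I FE E) :
    actSymbol L (fsmul f u) x = fsmulPair I FE E f (actSymbol L u x) := by
  rw [mem_symbolPairs] at hx
  refine Prod.ext ?_ ?_
  · ext v p
    simp only [actSymbol_apply, fsmulPair_apply, actDef_apply, Module.End.mul_apply,
      fsmulHom_apply, L.fsmul_mul, hx, map_add, LinearMap.add_apply, fsmul_apply,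
      ContMDiffSection.coe_add, ContMDiffSection.coe_sub, Pi.add_apply, Pi.sub_apply,
      smul_sub]
    abel
  · ext p
    simp only [actSymbol_apply, fsmulPair_apply, BundleMap.onSec_fsmul, vfBracket_fsmul_left, hx,
      map_add, fsmul_apply, ContMDiffSection.coe_add, ContMDiffSection.coe_sub, Pi.add_apply,
      Pi.sub_apply, smul_add]
    abel

theorem actSymbol_fsmulPair (f : C^∞⟮I, M; ℝ⟯) (u : Sec I FE E)
    (x : Module.End ℝ (Sec I FE E) × VField I M) :
    actSymbol L u (fsmulPair I FE E f x) = fsmulPair I FE E f (actSymbol L u x)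
      + fsmulPair I FE E (lieDeriv (L.anchor.onSec u) f) x := by
  refine Prod.ext ?_ ?_
  · ext v p
    simp only [actSymbol_apply, fsmulPair_apply, actDef_apply, Module.End.mul_apply, Prod.fst_add,
      fsmulHom_apply, L.fsmul_mul, L.mul_fsmul, map_add, LinearMap.add_apply, fsmul_apply,
      ContMDiffSection.coe_add, ContMDiffSection.coe_sub, Pi.add_apply, Pi.sub_apply,
      smul_sub]
    abel
  · ext p
    simp only [actSymbol_apply, fsmulPair_apply, BundleMap.onSec_fsmul, vfBracket_fsmul_right,
      Prod.snd_add, Module.End.mul_apply, fsmulHom_apply,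
      fsmul_apply, ContMDiffSection.coe_add, Pi.add_apply, smul_add]
    abel

/-- The commutator `[L_u, φ]` has as symbol the bracket of the symbols, by `dirDeriv_vfBracket`, and
`L_{φ(u)}` has symbol `a(φ u)`. -/
theorem actSymbol_mem_symbolPairs [FiniteDimensional ℝ B] [T2Space M] (u : Sec I FE E)
    {x : Module.End ℝ (Sec I FE E) × VField I M} (hx : x ∈ symbolPairs I FE E) :
    actSymbol L u x ∈ symbolPairs I FE E := by
  rw [mem_symbolPairs] at hx ⊢
  intro f v
  ext p
  have hadd : ∀ X Y : VField I M, dirDeriv (⇑X + ⇑Y) f p = dirDeriv X f p + dirDeriv Y f p :=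
    fun X Y => map_add (mvfderiv I f p) (X p) (Y p)
  simp only [actSymbol_apply, actDef_apply, hx, L.mul_fsmul, map_add, fsmul_apply,
    ContMDiffSection.coe_add, ContMDiffSection.coe_sub, Pi.add_apply, Pi.sub_apply, smul_add,
    smul_sub, lieDeriv_apply, hadd, dirDeriv_vfBracket, add_smul, sub_smul]
  abel

end Symbols

/-! ### The two complexes, the cochain map and cohomology. -/

section Main

variable {B : Type*} [NormedAddCommGroup B] [NormedSpace ℝ B] {H : Type*} [TopologicalSpace H]
  {I : ModelWithCorners ℝ B H} {M : Type*} [TopologicalSpace M] [ChartedSpace H M]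
  [IsManifold I ∞ M]
  {FA : Type*} [NormedAddCommGroup FA] [NormedSpace ℝ FA]
  {A : M → Type*} [TopologicalSpace (TotalSpace FA A)] [∀ x, AddCommGroup (A x)]
  [∀ x, Module ℝ (A x)] [∀ x, TopologicalSpace (A x)] [FiberBundle FA A] [VectorBundle ℝ FA A]
  [∀ x, IsTopologicalAddGroup (A x)] [∀ x, ContinuousSMul ℝ (A x)]
  {FE : Type*} [NormedAddCommGroup FE] [NormedSpace ℝ FE]
  {E : M → Type*} [TopologicalSpace (TotalSpace FE E)] [∀ x, AddCommGroup (E x)]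
  [∀ x, Module ℝ (E x)] [∀ x, TopologicalSpace (E x)] [FiberBundle FE E] [VectorBundle ℝ FE E]
  {𝒜 : LieAlgebroid I FA A} (ρ : Representation FE E 𝒜) (T : BundleMap I FE E FA A)
  (L : LeftSymmetricAlgebroid I FE E)

theorem dDef_dDef {k : ℕ} {D : Op₁ I FE E k} (hD : D ∈ Der I FE E k) :
    dDef L (k + 1) (dDef L k D) = 0 := by
  obtain ⟨σ, h⟩ := hD
  obtain ⟨D', hD'⟩ := h.multilinear
  obtain rfl : D = fun u v => D' u v := funext fun u => funext fun v => hD' u v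
  rw [dDef_alternatingMap, dDef_alternatingMap, ceDiff_ceDiff L.left_symm (actDef_commutator L)]
  rfl

theorem Phi_mem_Der {k : ℕ} {P : Op I FA A FE E k} (hP : P ∈ cochains I FA A FE E k) :
    Phi ρ k P ∈ Der I FE E k := by
  refine ⟨fun u => 𝒜.anchor.onSec (P u), ?_, ?_, ?_, ?_⟩
  · obtain ⟨φ, hφ⟩ := hP
    refine ⟨fun p => (𝒜.anchor p).toLinearMap.compAlternatingMap (φ p), fun u p => ?_⟩
    rw [BundleMap.onSec_apply, hφ]
    rfl
  · obtain ⟨P', hP'⟩ := exists_alternatingMap_of_mem_cochains hP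
    exact ⟨ρ.act.compAlternatingMap P', fun u v => congrArg (fun x => ρ.act x v) (hP' u)⟩
  · intro f u i v
    change ρ.act (P _) v = fsmul f (ρ.act (P u) v)
    rw [update_fsmul_of_mem_cochains hP, ρ.act_fsmul]
  · intro f u v p
    exact ρ.act_leibniz (P u) v f p

variable {T}

/-- The term `-a(x)(f) Tu` from the bracket cancels `T(a(x)(f) u)` from the Leibniz rule of `ρ`. -/
theorem actT_fsmul_left (f : C^∞⟮I, M; ℝ⟯) (u : Sec I FE E) (x : Sec I FA A) :
    actT ρ T (fsmul f u) x = fsmul f (actT ρ T u x) := by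
  have hl : ∀ x u, ρ.act x (fsmul f u)
      = fsmul f (ρ.act x u) + fsmul (lieDeriv (𝒜.anchor.onSec x) f) u := by
    intro x u; ext p; exact ρ.act_leibniz x u f p
  have hb : ∀ x y, 𝒜.bracket x (fsmul f y)
      = fsmul f (𝒜.bracket x y) + fsmul (lieDeriv (𝒜.anchor.onSec x) f) y := by
    intro x y; ext p; exact 𝒜.leibniz x y f p
  rw [actT_apply, actT_apply, BundleMap.onSec_fsmul, 𝒜.bracket_swap, hb,
    𝒜.bracket_swap (T.onSec u) x, hl, map_add, BundleMap.onSec_fsmul, BundleMap.onSec_fsmul]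
  ext p
  simp only [ContMDiffSection.coe_add, ContMDiffSection.coe_neg, Pi.add_apply, Pi.neg_apply,
    fsmul_apply, smul_add, smul_neg]
  abel

theorem actT_fsmul_right (f : C^∞⟮I, M; ℝ⟯) (u : Sec I FE E) (x : Sec I FA A) :
    actT ρ T u (fsmul f x) = fsmul f (actT ρ T u x)
      + fsmul (lieDeriv (𝒜.anchor.onSec (T.onSec u)) f) x := by
  have hb : 𝒜.bracket (T.onSec u) (fsmul f x) = fsmul f (𝒜.bracket (T.onSec u) x)
      + fsmul (lieDeriv (𝒜.anchor.onSec (T.onSec u)) f) x := by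
    ext p; exact 𝒜.leibniz _ x f p
  rw [actT_apply, actT_apply, hb, ρ.act_fsmul, BundleMap.onSec_fsmul]
  ext p
  simp only [ContMDiffSection.coe_add, Pi.add_apply, fsmul_apply, smul_add]
  abel

theorem dT_dT (hT : IsRelRotaBaxter ρ T) {k : ℕ} {P : Op I FA A FE E k}
    (hP : P ∈ cochains I FA A FE E k) : dT ρ T (k + 1) (dT ρ T k P) = 0 := by
  obtain ⟨P', hP'⟩ := exists_alternatingMap_of_mem_cochains hP
  obtain rfl : P = fun u => P' u := funext hP'
  have h : ceDiff (ρ.act ∘ₗ T.onSec) (actT ρ T) (k + 1)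
      (ceDiff (ρ.act ∘ₗ T.onSec) (actT ρ T) k P') = 0 :=
    ceDiff_ceDiff (inducedLSA ρ T hT).left_symm (actT_commutator ρ hT) P'
  rw [dT_alternatingMap, dT_alternatingMap, h]
  rfl

theorem dDef_Phi (hT : IsRelRotaBaxter ρ T) {k : ℕ} {P : Op I FA A FE E k}
    (hP : P ∈ cochains I FA A FE E k) :
    dDef (inducedLSA ρ T hT) k (Phi ρ k P) = Phi ρ (k + 1) (dT ρ T k P) := by
  obtain ⟨P', hP'⟩ := exists_alternatingMap_of_mem_cochains hP
  obtain rfl : P = fun u => P' u := funext hP'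
  have h := dDef_alternatingMap (inducedLSA ρ T hT) (ρ.act.compAlternatingMap P')
  rw [dT_alternatingMap]
  refine h.trans ?_
  have hc : ceDiff (inducedLSA ρ T hT).mul (actDef (inducedLSA ρ T hT)) k
      (ρ.act.compAlternatingMap P')
      = ρ.act.compAlternatingMap (ceDiff (ρ.act ∘ₗ T.onSec) (actT ρ T) k P') := by
    -- The intertwining `ρ([Tu, x] + T(ρ(x)u)) = [L_u, ρ(x)] + L_{ρ(x)u}`, with `L_u = ρ(Tu)`.
    refine ceDiff_compAlternatingMap _ _ fun u w => ?_
    ext1 v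
    rw [actT_apply, map_add, LinearMap.add_apply, ρ.act_bracket]
    rfl
  rw [hc]
  rfl

/-- `Φ` as a map from cocycles to cocycles. -/
def phiCocycles (hT : IsRelRotaBaxter ρ T) (k : ℕ) :
    cocyclesT ρ T k →ₗ[ℝ] cocyclesDef (inducedLSA ρ T hT) k :=
  (Phi ρ k).restrict fun P hP => by
    refine ⟨Phi_mem_Der ρ hP.1, ?_⟩
    change dDef (inducedLSA ρ T hT) k (Phi ρ k P) = 0
    rw [dDef_Phi ρ hT hP.1, LinearMap.mem_ker.1 hP.2, map_zero]

theorem coboundariesT_le_comap (hT : IsRelRotaBaxter ρ T) (k : ℕ) :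
    (coboundariesT ρ T k).submoduleOf (cocyclesT ρ T k)
      ≤ ((coboundariesDef (inducedLSA ρ T hT) k).submoduleOf
        (cocyclesDef (inducedLSA ρ T hT) k)).comap (phiCocycles ρ hT k) := by
  rintro ⟨P, hP⟩ hb
  rw [Submodule.mem_comap, Submodule.submoduleOf, Submodule.mem_comap]
  rw [Submodule.submoduleOf, Submodule.mem_comap] at hb
  change Phi ρ k P ∈ _
  change P ∈ _ at hb
  cases k with
  | zero =>
    rw [(Submodule.mem_bot ℝ).1 hb, map_zero]
    exact Submodule.zero_mem _
  | succ k =>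
    obtain ⟨Q, hQ, rfl⟩ := hb
    exact ⟨Phi ρ k Q, Phi_mem_Der ρ hQ, dDef_Phi ρ hT hQ⟩

variable [FiniteDimensional ℝ B] [T2Space M] [FiniteDimensional ℝ FE]
  [ContMDiffVectorBundle ∞ FE E I]

theorem dT_mem_cochains (hT : IsRelRotaBaxter ρ T) {k : ℕ} {P : Op I FA A FE E k}
    (hP : P ∈ cochains I FA A FE E k) : dT ρ T k P ∈ cochains I FA A FE E (k + 1) := by
  obtain ⟨P', hP'⟩ := exists_alternatingMap_of_mem_cochains hP
  obtain rfl : P = fun u => P' u := funext hP'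
  rw [dT_alternatingMap]
  refine mem_cochains_of_update_fsmul _ fun f u i => ?_
  have hlin : ∀ (f : C^∞⟮I, M; ℝ⟯) w i, P' (update w i (fsmul f (w i))) = fsmul f (P' w) :=
    update_fsmul_of_mem_cochains hP
  exact ceDiff_update P' (fsmulHom f) (fsmulHom f)
    (fun u w => fsmul (lieDeriv ((inducedLSA ρ T hT).anchor.onSec u) f) w)
    (fun u w => fsmul (lieDeriv ((inducedLSA ρ T hT).anchor.onSec u) f) w)
    (fun u w => (inducedLSA ρ T hT).fsmul_mul f u w)
    (fun u w => (inducedLSA ρ T hT).mul_fsmul u w f)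
    (fun u w => actT_fsmul_left ρ f u (P' w)) (fun u w => actT_fsmul_right ρ f u (P' w))
    (hlin f) (fun u w i => hlin _ w i) u i

/-- The differential of the pair `(D, σ)` has first component `d_def D`, and its second component
serves as the symbol, because the Leibniz pairs are stable under `actSymbol`. Only the function
rules of `actSymbol` are needed, not that it is a representation. -/
theorem dDef_mem_Der [CompleteSpace B] {k : ℕ} {D : Op₁ I FE E k} (hD : D ∈ Der I FE E k) :
    dDef L k D ∈ Der I FE E (k + 1) := by
  obtain ⟨σ, h⟩ := hD
  obtain ⟨D', hD'⟩ := h.multilinear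
  obtain ⟨σ', hσ'⟩ := exists_alternatingMap_of_mem_cochains h.symbol_mem
  obtain rfl : D = fun u v => D' u v := funext fun u => funext fun v => hD' u v
  obtain rfl : σ = fun u => σ' u := funext hσ'
  let P := D'.prod σ'
  have hP : ∀ u, P u = (D' u, σ' u) := fun _ => rfl
  have hmem : ∀ w, P w ∈ symbolPairs I FE E := by
    intro w f v
    ext p
    exact h.leibniz f w v p
  have hlin : ∀ (f : C^∞⟮I, M; ℝ⟯) w i,
      P (update w i (fsmul f (w i))) = fsmulPair I FE E f (P w) := by
    intro f w i
    refine Prod.ext ?_ ?_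
    · ext1 v
      exact h.fsmul_left f w i v
    · exact update_fsmul_of_mem_cochains h.symbol_mem f w i
  have hfst : (LinearMap.fst ℝ _ _).compAlternatingMap P = D' := rfl
  let dP := ceDiff L.mul (actSymbol L) k P
  have hdP : (LinearMap.fst ℝ _ _).compAlternatingMap dP = ceDiff L.mul (actDef L) k D' := by
    rw [← hfst]
    exact (ceDiff_compAlternatingMap _ _ fun u w => rfl).symm
  have hdP' : ∀ u, ceDiff L.mul (actDef L) k D' u = (dP u).1 := fun u => by rw [← hdP]; rfl
  have hdmem : ∀ w, dP w ∈ symbolPairs I FE E :=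
    ceDiff_mem _ _ hmem fun u x hx => actSymbol_mem_symbolPairs L u hx
  have hdlin : ∀ (f : C^∞⟮I, M; ℝ⟯) w i,
      dP (update w i (fsmul f (w i))) = fsmulPair I FE E f (dP w) := by
    intro f w i
    exact ceDiff_update P (fsmulHom f) (fsmulPair I FE E f)
      (fun u w => fsmul (lieDeriv (L.anchor.onSec u) f) w)
      (fun u => fsmulPair I FE E (lieDeriv (L.anchor.onSec u) f))
      (fun u w => L.fsmul_mul f u w) (fun u w => L.mul_fsmul u w f)
      (fun u w => actSymbol_fsmul_left L f u (hmem w))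
      (fun u w => actSymbol_fsmulPair L f u (P w))
      (fun w i => hlin f w i) (fun u w i => hlin _ w i) w i
  rw [dDef_alternatingMap]
  refine ⟨fun u => (dP u).2, ?_, ⟨_, fun _ _ => rfl⟩, ?_, ?_⟩
  · exact mem_cochains_of_update_fsmul ((LinearMap.snd ℝ _ _).compAlternatingMap dP)
      fun f u i => congrArg Prod.snd (hdlin f u i)
  · intro f u i v
    simp only [hdP']
    exact congrArg (fun x => x.1 v) (hdlin f u i)
  · intro f u v p
    simp only [hdP']
    exact congrArg (fun s : Sec I FE E => s p) (hdmem u f v)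

end Main

end LieAlgd

end

theorem theorem5p11 {d : ℕ} {M : Type*} [TopologicalSpace M] [T2Space M]
    [SecondCountableTopology M] [ChartedSpace (EuclideanSpace ℝ (Fin d)) M]
    [IsManifold (𝓡 d) ∞ M]
    {FA : Type*} [NormedAddCommGroup FA] [NormedSpace ℝ FA] [FiniteDimensional ℝ FA]
    {A : M → Type*} [TopologicalSpace (TotalSpace FA A)] [∀ x, AddCommGroup (A x)]
    [∀ x, Module ℝ (A x)] [∀ x, TopologicalSpace (A x)] [FiberBundle FA A]
    [VectorBundle ℝ FA A] [ContMDiffVectorBundle ∞ FA A (𝓡 d)]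
    [∀ x, IsTopologicalAddGroup (A x)] [∀ x, ContinuousSMul ℝ (A x)]
    {FE : Type*} [NormedAddCommGroup FE] [NormedSpace ℝ FE] [FiniteDimensional ℝ FE]
    {E : M → Type*} [TopologicalSpace (TotalSpace FE E)] [∀ x, AddCommGroup (E x)]
    [∀ x, Module ℝ (E x)] [∀ x, TopologicalSpace (E x)] [FiberBundle FE E]
    [VectorBundle ℝ FE E] [ContMDiffVectorBundle ∞ FE E (𝓡 d)]
    {𝒜 : LieAlgd.LieAlgebroid (𝓡 d) FA A} (ρ : LieAlgd.Representation FE E 𝒜)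
    (T : LieAlgd.BundleMap (𝓡 d) FE E FA A) (hT : LieAlgd.IsRelRotaBaxter ρ T) :
    -- `(C^*(E, A), d_T)` is a cochain complex
    (∀ k, ∀ P ∈ LieAlgd.cochains (𝓡 d) FA A FE E k,
      LieAlgd.dT ρ T k P ∈ LieAlgd.cochains (𝓡 d) FA A FE E (k + 1) ∧
      LieAlgd.dT ρ T (k + 1) (LieAlgd.dT ρ T k P) = 0) ∧
    -- `(Der^*(E), d_def)` is a cochain complex
    (∀ k, ∀ D ∈ LieAlgd.Der (𝓡 d) FE E k,
      LieAlgd.dDef (LieAlgd.inducedLSA ρ T hT) k D ∈ LieAlgd.Der (𝓡 d) FE E (k + 1) ∧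
      LieAlgd.dDef (LieAlgd.inducedLSA ρ T hT) (k + 1)
        (LieAlgd.dDef (LieAlgd.inducedLSA ρ T hT) k D) = 0) ∧
    -- `Φ` is a cochain map
    (∀ k, ∀ P ∈ LieAlgd.cochains (𝓡 d) FA A FE E k,
      LieAlgd.Phi ρ k P ∈ LieAlgd.Der (𝓡 d) FE E k ∧
      LieAlgd.dDef (LieAlgd.inducedLSA ρ T hT) k (LieAlgd.Phi ρ k P)
        = LieAlgd.Phi ρ (k + 1) (LieAlgd.dT ρ T k P)) ∧
    -- `Φ` induces homomorphisms in cohomology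
    (∀ k, ∃ Φs : LieAlgd.HT ρ T k →ₗ[ℝ] LieAlgd.HDef (LieAlgd.inducedLSA ρ T hT) k,
      ∀ P : LieAlgd.cocyclesT ρ T k,
        ∃ hP : LieAlgd.Phi ρ k P ∈ LieAlgd.cocyclesDef (LieAlgd.inducedLSA ρ T hT) k,
          Φs (Submodule.Quotient.mk P) = Submodule.Quotient.mk ⟨LieAlgd.Phi ρ k P, hP⟩) :=
  ⟨fun _ _ hP => ⟨LieAlgd.dT_mem_cochains ρ hT hP, LieAlgd.dT_dT ρ hT hP⟩,
    fun _ _ hD => ⟨LieAlgd.dDef_mem_Der _ hD, LieAlgd.dDef_dDef _ hD⟩,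
    fun _ _ hP => ⟨LieAlgd.Phi_mem_Der ρ hP, LieAlgd.dDef_Phi ρ hT hP⟩,
    fun k => ⟨Submodule.mapQ _ _ (LieAlgd.phiCocycles ρ hT k)
      (LieAlgd.coboundariesT_le_comap ρ hT k),
      fun P => ⟨(LieAlgd.phiCocycles ρ hT k P).2, rfl⟩⟩⟩
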